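/- **Setting.** Let $\varepsilon>0$, and for each site $x\in\{1,2\}$ let $P_0^x(d\omega)$ be a measure on $\mathbb R$ (the $N\to\infty$ limit of the initial energy distribution at site $x$) with $P_0^1(\mathbb R)+P_0^2(\mathbb R)=1$ and $P_0^x(\{\omega\le\varepsilon\}\cup\{\omega\ge 1-\varepsilon\})=0$. Write $P_0(x,d\omega)=P_0^x(d\omega)$ for terms of order $n$ even and $P_0(x,d\omega)=P_0^{\bar x}(d\omega)$ for $n$ odd, $\bar x$ being the other site. *Graphs.* A graph $\pi(n,m)$ is a perfect pairing of $X_1,\dots,X_{m+n}$; the first $m$ factors are called primed, the last $n$ unprimed. It has a crossing if it contains pairs $(i,j),(k,l)$ with $i<k<j<l$, and a nest if it contains pairs $(i,j),(k,l)$ with $i<k<l<j$ and $j\le m$ or $m<i$. It is simple, $\pi\in\mathcal G_0(n,m)$, if it has neither. List the energy variables $E'_m,\dots,E'_1,E_0,E_1,\dots,E_n$ (with $E_0'=E_0$) as $e_0,\dots,e_{n+m}$. A pair $(l,p)$ identifies $e_{l-1}$ with $e_p$ and $e_l$ with $e_{p-1}$; the resulting classes are the independent variables of $\pi$. For a class $c$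 let $k_c$ be the number of $i\in\{0,\dots,n\}$ with $E_i\in c$ and $p_c$ the number of $j\in\{0,\dots,m\}$ with $E'_j\in c$. Let $c_*$ be the class of $E_n$. *Integrals.* For $\eta>0$ put $\Theta(\alpha,\eta)=\int_0^1\frac{-1}{\omega-\alpha-i\eta}\,d\omega$ and $\Theta(\omega)=\lim_{\eta\downarrow0}\Theta(\omega,\eta)$ for $0<\omega<1$. With $\eta=1/t$ let $$Q_\pi(t,\lambda,x)=\frac{\lambda^{n+m}}{(2\pi)^2}\int d\alpha\,d\beta\,e^{-i(\alpha-\beta)t}e^{2\eta t}\int P_0(x,dw)\Big(\tfrac{-1}{w-\alpha-i\eta}\Big)^{k_{c_*}}\Big(\tfrac{-1}{w-\beta+i\eta}\Big)^{p_{c_*}}\prod_{c\ne c_*}I_c(\alpha,\beta),$$ $$I_c(\alpha,\beta)=\int_0^1 d\omega\Big(\tfrac{-1}{\omega-\alpha-i\eta}\Big)^{k_c}\Big(\tfrac{-1}{\omega-\beta+i\eta}\Big)^{p_c},$$ so that $I_c=\Theta(\alpha,\eta)$ if $(k_c,p_c)=(1,0)$ and $I_c=\overline{\Theta(\beta,\eta)}$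 if $(k_c,p_c)=(0,1)$. Let $\tilde Q_\pi$ be the same expression with these self-energy factors replaced by $\Theta(w)$ and $\overline{\Theta(w)}$ respectively, all other factors unchanged. The $(\alpha,\beta)$-integrals are limits as $R\to\infty$ of integrals over $[-R,R]^2$. Finally $$P^{x,M}_{0,t}=\sum_{n,m=0}^M\sum_{\pi\in\mathcal G_0(n,m)}Q_\pi(t,\lambda,x),\qquad \tilde P^{x,M}_{0,t}=\sum_{n,m=0}^M\sum_{\pi\in\mathcal G_0(n,m)}\tilde Q_\pi(t,\lambda,x).$$ **Theorem.** 1. The limit $\Theta(\omega)$ exists for every $\omega\in(0,1)$, and for every simple graph, $x$, $t>0$ and $\lambda\in\mathbb R$ the limits defining $Q_\pi$ and $\tilde Q_\pi$ exist. 2. There is a constant $C>0$ depending only on $\varepsilon$ such that for all such $P_0$, all $n,m$, all simple graphs $\pi\in\mathcal G_0(n,m)$, all $x$, all $t\ge2$ and all $\lambda\in\mathbb R$, with $T=\lambda^2t$, $$\big|Q_\pi(t,\lambda,x)-\tilde Q_\pi(t,\lambda,x)\big|\le (CT)^{\frac{n+m}2}\,\frac{(\log t)^{\frac{n+m}2+5}}{t}.$$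 3. In the Van Hove limit, for all such $P_0$, all $M$, $x$ and $T$, $$\lim_{t\to\infty,\ \lambda^2t=T}\big(\tilde P^{x,M}_{0,t}-P^{x,M}_{0,t}\big)=0.$$ -/

import Mathlib

open MeasureTheory Filter Topology

namespace TwoSite

/-- A graph `π(n,m)`: a perfect pairing of the `n + m` random factors
`X_1 ⋯ X_m X_{m+1} ⋯ X_{m+n}` (here numbered `0, …, n + m - 1`), encoded by the map sending each
factor to its partner. The first `m` factors come from the conjugated amplitude ("primed"), the
last `n` ones from the amplitude itself. -/
structure Pairing (n m : ℕ) where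
  partner : Fin (n + m) → Fin (n + m)
  involutive : Function.Involutive partner
  ne_self : ∀ l, partner l ≠ l

variable {n m : ℕ}

theorem Pairing.partner_injective : Function.Injective (Pairing.partner (n := n) (m := m)) := by
  rintro ⟨f, _, _⟩ ⟨g, _, _⟩ h
  cases h
  rfl

noncomputable instance : Fintype (Pairing n m) :=
  Fintype.ofInjective _ Pairing.partner_injective

/-- There are contractions `(i,j)` and `(k,l)` with `i < k < j < l`. -/
def Pairing.HasCrossing (π : Pairing n m) : Prop :=
  ∃ i k : Fin (n + m), i < k ∧ k < π.partner i ∧ π.partner i < π.partner k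

/-- There are contractions `(i,j)` and `(k,l)` with `i < k < l < j`, all four factors being primed
or all four being unprimed. -/
def Pairing.HasNest (π : Pairing n m) : Prop :=
  ∃ i k : Fin (n + m), i < k ∧ k < π.partner k ∧ π.partner k < π.partner i ∧
    ((π.partner i).val < m ∨ m ≤ i.val)

/-- Simple graphs: neither a crossing nor a nest. -/
def Pairing.IsSimple (π : Pairing n m) : Prop :=
  ¬ π.HasCrossing ∧ ¬ π.HasNest

/-- The energy variables `E'_m, …, E'_1, E_0, E_1, …, E_n` are numbered `0, …, n + m` in this
order: `E_i` has number `m + i`, `E'_j` has number `m - j`, and `E'_0 = E_0` has number `m`.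
The factor `X_l` carries the energies number `l` and `l + 1`, and the contraction of `X_l` with
`X_p` imposes that energies `l` and `p + 1` agree and that energies `l + 1` and `p` agree. -/
inductive Pairing.Linked (π : Pairing n m) : Fin (n + m + 1) → Fin (n + m + 1) → Prop
  | contract (l : Fin (n + m)) : Pairing.Linked π l.castSucc (π.partner l).succ

/-- The independent energy variables of a graph: the classes of energy variables identified by
the Kronecker deltas of the graph function. -/
def Pairing.EnergyClass (π : Pairing n m) : Type :=
  Quotient (Relation.EqvGen.setoid π.Linked)

/-- The independent variable to which an energy variable is identified. -/
def Pairing.classOf (π : Pairing n m) (i : Fin (n + m + 1)) : π.EnergyClass :=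
  Quotient.mk (Relation.EqvGen.setoid π.Linked) i

noncomputable instance (π : Pairing n m) : Fintype π.EnergyClass :=
  have : Finite π.EnergyClass := inferInstanceAs (Finite (Quotient _))
  Fintype.ofFinite _

/-- The independent variable of `E_n`, the one which carries the initial data. -/
def Pairing.lastClass (π : Pairing n m) : π.EnergyClass :=
  π.classOf (Fin.last (n + m))

open Classical in
/-- Left multiplicity: the number of `i ∈ {0, …, n}` with `E_i` in the class `c`. -/
noncomputable def Pairing.leftMult (π : Pairing n m) (c : π.EnergyClass) : ℕ :=
  (Finset.univ.filter fun i : Fin (n + m + 1) => m ≤ i.val ∧ π.classOf i = c).card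

open Classical in
/-- Right multiplicity: the number of `j ∈ {0, …, m}` with `E'_j` in the class `c`. -/
noncomputable def Pairing.rightMult (π : Pairing n m) (c : π.EnergyClass) : ℕ :=
  (Finset.univ.filter fun i : Fin (n + m + 1) => i.val ≤ m ∧ π.classOf i = c).card

/-- The propagator `-1 / (ω - α - iη)`. -/
noncomputable def prop (α η ω : ℝ) : ℂ := -1 / ((ω : ℂ) - α - Complex.I * η)

/-- The propagator `-1 / (ω - β + iη)`. -/
noncomputable def propBar (β η ω : ℝ) : ℂ := -1 / ((ω : ℂ) - β + Complex.I * η)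

/-- The self-energy `Θ(α,η) = ∫₀¹ dω (-1) / (ω - α - iη)`. -/
noncomputable def selfEnergy (α η : ℝ) : ℂ := ∫ ω in (0 : ℝ)..1, prop α η ω

/-- The boundary value `Θ(ω) = lim_{η ↓ 0} Θ(ω,η)`. -/
noncomputable def boundarySelfEnergy (ω : ℝ) : ℂ :=
  limUnder (𝓝[>] (0 : ℝ)) fun η => selfEnergy ω η

/-- The integral over `[0,1]` of the propagators of one independent energy variable, of left
multiplicity `k` and right multiplicity `p`. -/
noncomputable def classIntegral (α β η : ℝ) (k p : ℕ) : ℂ :=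
  ∫ ω in (0 : ℝ)..1, prop α η ω ^ k * propBar β η ω ^ p

/-- A variable of multiplicity one on the left contributes the factor `Θ(α,η)`. -/
theorem classIntegral_one_zero (α β η : ℝ) : classIntegral α β η 1 0 = selfEnergy α η := by
  simp [classIntegral, selfEnergy]

theorem conj_prop (β η ω : ℝ) : (starRingEnd ℂ) (prop β η ω) = propBar β η ω := by
  simp [prop, propBar]

/-- A variable of multiplicity one on the right contributes the factor `conj Θ(β,η)`. -/
theorem classIntegral_zero_one (α β η : ℝ) :
    classIntegral α β η 0 1 = (starRingEnd ℂ) (selfEnergy β η) := by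
  simp only [classIntegral, selfEnergy, pow_zero, pow_one, one_mul,
    intervalIntegral.integral_of_le zero_le_one, ← integral_conj, conj_prop]

/-- The same factor after the replacement of `Θ(α,η)` and `conj Θ(β,η)` by the boundary values
`Θ(w)` and `conj Θ(w)`; the variables of higher multiplicity are left untouched. -/
noncomputable def replacedClassIntegral (w α β η : ℝ) (k p : ℕ) : ℂ :=
  if k = 1 ∧ p = 0 then boundarySelfEnergy w
  else if k = 0 ∧ p = 1 then (starRingEnd ℂ) (boundarySelfEnergy w)
  else classIntegral α β η k p

/-- The energy distribution `P_0(x, dω)` entering terms of order `n`: the initial energy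
distribution at site `x` if `n` is even, and at the other site if `n` is odd. -/
noncomputable def initialAt (P0 : Fin 2 → Measure ℝ) (x : Fin 2) (n : ℕ) : Measure ℝ :=
  if Even n then P0 x else P0 (1 - x)

/-- `P0 x` is the (limiting) energy distribution at site `x` of a normalized initial state with no
population within distance `ε` of the edges of the spectrum `[0,1]`. -/
structure IsInitialDistribution (ε : ℝ) (P0 : Fin 2 → Measure ℝ) : Prop where
  total_mass : P0 0 Set.univ + P0 1 Set.univ = 1
  edges : ∀ x, P0 x {ω | ω ≤ ε ∨ 1 - ε ≤ ω} = 0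

/-- Common form of the `α`-representation, with the `α` and `β` integrations over `[-R,R]`:
`F w α β c` is the factor of the independent variable `c` when the variable `ω` of the initial
data has the value `w`, and `η = 1/t`. -/
noncomputable def truncatedAlphaRep (P0 : Fin 2 → Measure ℝ) (π : Pairing n m) (x : Fin 2)
    (t lam : ℝ) (F : ℝ → ℝ → ℝ → π.EnergyClass → ℂ) (R : ℝ) : ℂ :=
  open Classical in
  (lam : ℂ) ^ (n + m) * (1 / (2 * (Real.pi : ℂ)) ^ 2) *
    ∫ α in (-R)..R, ∫ β in (-R)..R,
      Complex.exp (-Complex.I * (α - β) * t) * Complex.exp (2 * (t⁻¹ : ℝ) * t) *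
        ∫ w, prop α t⁻¹ w ^ π.leftMult π.lastClass * propBar β t⁻¹ w ^ π.rightMult π.lastClass *
          ∏ c ∈ Finset.univ.erase π.lastClass, F w α β c ∂(initialAt P0 x n)

/-- `Q_π(t,λ,x)` with the `α` and `β` integrations restricted to `[-R,R]`. -/
noncomputable def QTrunc (P0 : Fin 2 → Measure ℝ) (π : Pairing n m) (x : Fin 2) (t lam R : ℝ) :
    ℂ :=
  truncatedAlphaRep P0 π x t lam
    (fun _ α β c => classIntegral α β t⁻¹ (π.leftMult c) (π.rightMult c)) R

/-- `Q̃_π(t,λ,x)` with the `α` and `β` integrations restricted to `[-R,R]`. -/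
noncomputable def QTildeTrunc (P0 : Fin 2 → Measure ℝ) (π : Pairing n m) (x : Fin 2)
    (t lam R : ℝ) : ℂ :=
  truncatedAlphaRep P0 π x t lam
    (fun w α β c => replacedClassIntegral w α β t⁻¹ (π.leftMult c) (π.rightMult c)) R

/-- The contribution `Q_π(t,λ,x)` of the graph `π` to the probability to be at `x`. -/
noncomputable def Q (P0 : Fin 2 → Measure ℝ) (π : Pairing n m) (x : Fin 2) (t lam : ℝ) : ℂ :=
  limUnder atTop (QTrunc P0 π x t lam)

/-- `Q̃_π(t,λ,x)`, in which the self-energy factors are replaced by their boundary values. -/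
noncomputable def QTilde (P0 : Fin 2 → Measure ℝ) (π : Pairing n m) (x : Fin 2) (t lam : ℝ) : ℂ :=
  limUnder atTop (QTildeTrunc P0 π x t lam)

open Classical in
/-- `P^{x,M}_{0,t}`: the contribution of the simple graphs to the probability truncated at
order `M`. -/
noncomputable def simpleProb (P0 : Fin 2 → Measure ℝ) (M : ℕ) (x : Fin 2) (t lam : ℝ) : ℂ :=
  ∑ n ∈ Finset.range (M + 1), ∑ m ∈ Finset.range (M + 1),
    ∑ π : Pairing n m with π.IsSimple, Q P0 π x t lam

open Classical in
/-- `P̃^{x,M}_{0,t}`: the same sum after the replacement of the self-energy factors. -/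
noncomputable def simpleProbTilde (P0 : Fin 2 → Measure ℝ) (M : ℕ) (x : Fin 2) (t lam : ℝ) : ℂ :=
  ∑ n ∈ Finset.range (M + 1), ∑ m ∈ Finset.range (M + 1),
    ∑ π : Pairing n m with π.IsSimple, QTilde P0 π x t lam

end TwoSite

namespace TwoSite

namespace Pairing

variable {n m : ℕ} (π : Pairing n m)

theorem partner_partner (l : Fin (n + m)) : π.partner (π.partner l) = l := π.involutive l

theorem classOf_castSucc (l : Fin (n + m)) :
    π.classOf l.castSucc = π.classOf (π.partner l).succ :=
  Quotient.sound (Relation.EqvGen.rel _ _ (Linked.contract l))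

theorem classOf_succ (l : Fin (n + m)) :
    π.classOf l.succ = π.classOf (π.partner l).castSucc := by
  rw [classOf_castSucc, partner_partner]

/-- A function of the energy variables which respects the contractions is constant on classes. -/
theorem apply_eq_of_classOf_eq {γ : Sort*} (f : Fin (n + m + 1) → γ)
    (hf : ∀ l : Fin (n + m), f l.castSucc = f (π.partner l).succ) {i j : Fin (n + m + 1)}
    (h : π.classOf i = π.classOf j) : f i = f j := by
  have h' : Relation.EqvGen π.Linked i j :=
    Quotient.exact (s := Relation.EqvGen.setoid π.Linked) h
  clear h
  induction h' with
  | rel _ _ h => cases h; exact hf _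
  | refl => rfl
  | symm _ _ _ ih => exact ih.symm
  | trans _ _ _ _ _ ih1 ih2 => exact ih1.trans ih2

/-- The energy variable inside a contraction of neighbours is alone in its class. -/
theorem eq_of_classOf_eq_of_gate {l q : Fin (n + m)} (hlq : π.partner l = q)
    (hq : q.val = l.val + 1) {i : Fin (n + m + 1)} (h : π.classOf i = π.classOf q.castSucc) :
    i = q.castSucc := by
  have := π.apply_eq_of_classOf_eq (fun j => j = q.castSucc) (fun l' => by
    apply propext
    have h1 : π.partner q = l := by rw [← hlq, partner_partner]
    constructor
    · intro e
      have : l' = q := Fin.castSucc_injective _ e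
      subst this
      ext
      simp [h1, hq]
    · intro e
      have h2 : (π.partner l') = l := by
        have := congrArg Fin.val e
        ext
        simp at this
        omega
      have h3 : l' = q := by rw [← hlq, ← h2, partner_partner]
      rw [h3]) h
  simpa using this

theorem exists_isLeast_class (c : π.EnergyClass) :
    ∃ i, π.classOf i = c ∧ ∀ j, π.classOf j = c → i ≤ j := by
  classical
  obtain ⟨i₀, hi₀⟩ := Quotient.exists_rep c
  obtain ⟨i, hi, hmin⟩ := Finset.exists_min_image
    (Finset.univ.filter fun i => π.classOf i = c) id ⟨i₀, Finset.mem_filter.2 ⟨Finset.mem_univ _, hi₀⟩⟩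
  exact ⟨i, by simpa using hi, fun j hj => hmin j (by simpa using hj)⟩

theorem exists_isGreatest_class (c : π.EnergyClass) :
    ∃ i, π.classOf i = c ∧ ∀ j, π.classOf j = c → j ≤ i := by
  classical
  obtain ⟨i₀, hi₀⟩ := Quotient.exists_rep c
  obtain ⟨i, hi, hmax⟩ := Finset.exists_max_image
    (Finset.univ.filter fun i => π.classOf i = c) id ⟨i₀, Finset.mem_filter.2 ⟨Finset.mem_univ _, hi₀⟩⟩
  exact ⟨i, by simpa using hi, fun j hj => hmax j (by simpa using hj)⟩

variable {π}

/-- In a simple graph a class of unprimed variables comes from a contraction of neighbours. -/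
theorem IsSimple.exists_gate_of_unprimed (hπ : π.IsSimple) {c : π.EnergyClass}
    (hc : ∀ i, π.classOf i = c → m < i.val) :
    ∃ l q : Fin (n + m), π.partner l = q ∧ q.val = l.val + 1 ∧ m ≤ l.val ∧
      c = π.classOf q.castSucc := by
  obtain ⟨i, hi, hmin⟩ := π.exists_isLeast_class c
  have hmi := hc i hi
  obtain ⟨l, rfl⟩ : ∃ l : Fin (n + m), i = l.succ :=
    ⟨i.pred (by rintro rfl; simp at hmi), by simp⟩
  have hp := hmin _ ((π.classOf_succ l).symm.trans hi)
  rw [Fin.le_def] at hp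
  simp only [Fin.val_succ, Fin.val_castSucc] at hp hmi
  by_cases hpl : (π.partner l).val = l.val + 1
  · exact ⟨l, π.partner l, rfl, hpl, by omega, by rw [← hi, π.classOf_succ]⟩
  exfalso
  have hpn := (π.partner l).isLt
  set q : Fin (n + m) := ⟨l.val + 1, by omega⟩ with hq
  have hqv : q.val = l.val + 1 := rfl
  have hrl : (π.partner q).val ≠ l.val := fun h => by
    have : π.partner q = l := Fin.ext h
    rw [← this, partner_partner] at hpl
    exact hpl (by rw [this, hqv])
  have hrp : (π.partner q).val ≠ (π.partner l).val := fun h => by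
    have := congrArg Fin.val (π.involutive.injective (Fin.ext h))
    omega
  have hrq : (π.partner q).val ≠ q.val := fun h => π.ne_self q (Fin.ext h)
  rcases lt_or_ge (π.partner q).val l.val with h | h
  · exact hπ.1 ⟨π.partner q, l, h, by rw [partner_partner, Fin.lt_def]; omega,
      by rw [partner_partner, Fin.lt_def]; omega⟩
  rcases lt_or_ge (π.partner l).val (π.partner q).val with h' | h'
  · exact hπ.1 ⟨l, q, by rw [Fin.lt_def]; omega, by rw [Fin.lt_def]; omega, h'⟩
  · exact hπ.2 ⟨l, q, by rw [Fin.lt_def]; omega, by rw [Fin.lt_def]; omega,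
      by rw [Fin.lt_def]; omega, by omega⟩

/-- In a simple graph a class of primed variables comes from a contraction of neighbours. -/
theorem IsSimple.exists_gate_of_primed (hπ : π.IsSimple) {c : π.EnergyClass}
    (hc : ∀ i, π.classOf i = c → i.val < m) :
    ∃ l q : Fin (n + m), π.partner l = q ∧ q.val = l.val + 1 ∧ q.val < m ∧
      c = π.classOf q.castSucc := by
  obtain ⟨i, hi, hmax⟩ := π.exists_isGreatest_class c
  have hmi := hc i hi
  obtain ⟨a, rfl⟩ : ∃ a : Fin (n + m), i = a.castSucc :=
    ⟨⟨i.val, by omega⟩, by ext; simp⟩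
  have hp := hmax _ ((π.classOf_castSucc a).symm.trans hi)
  rw [Fin.le_def] at hp
  simp only [Fin.val_succ, Fin.val_castSucc] at hp hmi
  by_cases hpl : (π.partner a).val + 1 = a.val
  · exact ⟨π.partner a, a, π.partner_partner a, by omega, hmi, hi.symm⟩
  exfalso
  set b : Fin (n + m) := ⟨a.val - 1, by omega⟩ with hb
  have hbv : b.val = a.val - 1 := rfl
  have hra : (π.partner b).val ≠ a.val := fun h => by
    have : π.partner b = a := Fin.ext h
    rw [← this, partner_partner] at hpl
    omega
  have hrp : (π.partner b).val ≠ (π.partner a).val := fun h => by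
    have := congrArg Fin.val (π.involutive.injective (Fin.ext h))
    omega
  have hrb : (π.partner b).val ≠ b.val := fun h => π.ne_self b (Fin.ext h)
  rcases lt_or_ge (π.partner b).val (π.partner a).val with h | h
  · exact hπ.1 ⟨π.partner b, π.partner a, h, by rw [partner_partner, Fin.lt_def]; omega,
      by rw [partner_partner, partner_partner, Fin.lt_def]; omega⟩
  rcases lt_or_ge a.val (π.partner b).val with h' | h'
  · exact hπ.1 ⟨π.partner a, b, by rw [Fin.lt_def]; omega,
      by rw [partner_partner, Fin.lt_def]; omega, by rw [partner_partner, Fin.lt_def]; omega⟩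
  · exact hπ.2 ⟨π.partner a, π.partner b, by rw [Fin.lt_def]; omega,
      by rw [partner_partner, Fin.lt_def]; omega,
      by rw [partner_partner, partner_partner, Fin.lt_def]; omega,
      by rw [partner_partner]; omega⟩

theorem leftMult_eq_zero_iff {c : π.EnergyClass} :
    π.leftMult c = 0 ↔ ∀ i, π.classOf i = c → i.val < m := by
  simp only [leftMult, Finset.card_eq_zero, Finset.filter_eq_empty_iff, Finset.mem_univ,
    true_implies]
  exact forall_congr' fun i => ⟨fun h e => by by_contra h'; exact h ⟨by omega, e⟩,
    fun h h' => by have := h h'.2; omega⟩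

theorem rightMult_eq_zero_iff {c : π.EnergyClass} :
    π.rightMult c = 0 ↔ ∀ i, π.classOf i = c → m < i.val := by
  simp only [rightMult, Finset.card_eq_zero, Finset.filter_eq_empty_iff, Finset.mem_univ,
    true_implies]
  exact forall_congr' fun i => ⟨fun h e => by by_contra h'; exact h ⟨by omega, e⟩,
    fun h h' => by have := h h'.2; omega⟩

theorem IsSimple.leftMult_eq_one_of_rightMult_eq_zero (hπ : π.IsSimple) {c : π.EnergyClass}
    (hc : π.rightMult c = 0) :
    π.leftMult c = 1 ∧ c ≠ π.lastClass ∧ ∃ c', 2 ≤ π.leftMult c' := by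
  classical
  obtain ⟨l, q, hlq, hq, hl, rfl⟩ := hπ.exists_gate_of_unprimed (rightMult_eq_zero_iff.1 hc)
  refine ⟨?_, ?_, π.classOf l.castSucc, ?_⟩
  · rw [leftMult, Finset.card_eq_one]
    refine ⟨q.castSucc, ?_⟩
    ext i
    simp only [Finset.mem_filter, Finset.mem_univ, true_and, Finset.mem_singleton]
    refine ⟨fun h => π.eq_of_classOf_eq_of_gate hlq hq h.2, ?_⟩
    rintro rfl
    exact ⟨by simp; omega, rfl⟩
  · intro h
    have := congrArg Fin.val (π.eq_of_classOf_eq_of_gate hlq hq (i := Fin.last _) h.symm)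
    simp at this
    omega
  · rw [leftMult]
    refine Nat.succ_le_of_lt (Finset.one_lt_card.2 ⟨l.castSucc, by simpa using hl, q.succ, ?_, ?_⟩)
    · simp only [Finset.mem_filter, Finset.mem_univ, true_and, Fin.val_succ]
      refine ⟨by omega, ?_⟩
      rw [classOf_castSucc, hlq]
    · intro h
      have := congrArg Fin.val h
      simp at this
      omega

theorem IsSimple.rightMult_eq_one_of_leftMult_eq_zero (hπ : π.IsSimple) {c : π.EnergyClass}
    (hc : π.leftMult c = 0) :
    π.rightMult c = 1 ∧ ∃ c', 2 ≤ π.rightMult c' := by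
  classical
  obtain ⟨l, q, hlq, hq, hl, rfl⟩ := hπ.exists_gate_of_primed (leftMult_eq_zero_iff.1 hc)
  refine ⟨?_, π.classOf l.castSucc, ?_⟩
  · rw [rightMult, Finset.card_eq_one]
    refine ⟨q.castSucc, ?_⟩
    ext i
    simp only [Finset.mem_filter, Finset.mem_univ, true_and, Finset.mem_singleton]
    refine ⟨fun h => π.eq_of_classOf_eq_of_gate hlq hq h.2, ?_⟩
    rintro rfl
    exact ⟨by simp; omega, rfl⟩
  · rw [rightMult]
    refine Nat.succ_le_of_lt (Finset.one_lt_card.2 ⟨l.castSucc, ?_, q.succ, ?_, ?_⟩)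
    · simp only [Finset.mem_filter, Finset.mem_univ, true_and, Fin.val_castSucc]
      exact ⟨by omega, trivial⟩
    · simp only [Finset.mem_filter, Finset.mem_univ, true_and, Fin.val_succ]
      refine ⟨by omega, ?_⟩
      rw [classOf_castSucc, hlq]
    · intro h
      have := congrArg Fin.val h
      simp at this
      omega

variable (π) in
theorem one_le_leftMult_lastClass : 1 ≤ π.leftMult π.lastClass := by
  rw [Nat.one_le_iff_ne_zero, Ne, leftMult_eq_zero_iff]
  intro h
  have := h (Fin.last _) rfl
  simp at this

theorem IsSimple.one_le_rightMult_lastClass (hπ : π.IsSimple) :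
    1 ≤ π.rightMult π.lastClass := by
  rw [Nat.one_le_iff_ne_zero]
  exact fun h => (hπ.leftMult_eq_one_of_rightMult_eq_zero h).2.1 rfl

variable (π) in
theorem sum_leftMult : ∑ c, π.leftMult c = n + 1 := by
  classical
  have h := Finset.card_eq_sum_card_fiberwise (f := π.classOf)
    (s := Finset.univ.filter fun i : Fin (n + m + 1) => m ≤ i.val) (t := Finset.univ)
    (fun _ _ => Finset.mem_coe.2 (Finset.mem_univ _))
  simp only [Finset.filter_filter] at h
  have h2 : (Finset.univ.filter fun i : Fin (n + m + 1) => m ≤ i.val).card = n + 1 := by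
    have : (Finset.univ.filter fun i : Fin (n + m + 1) => m ≤ i.val) =
        Finset.Ici (⟨m, by omega⟩ : Fin (n + m + 1)) := by
      ext i; simp [Fin.le_def]
    rw [this, Fin.card_Ici]
    simp
    omega
  rw [← h2, h]
  exact Finset.sum_congr rfl fun c _ => by rw [leftMult]

variable (π) in
theorem sum_rightMult : ∑ c, π.rightMult c = m + 1 := by
  classical
  have h := Finset.card_eq_sum_card_fiberwise (f := π.classOf)
    (s := Finset.univ.filter fun i : Fin (n + m + 1) => i.val ≤ m) (t := Finset.univ)
    (fun _ _ => Finset.mem_coe.2 (Finset.mem_univ _))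
  simp only [Finset.filter_filter] at h
  have h2 : (Finset.univ.filter fun i : Fin (n + m + 1) => i.val ≤ m).card = m + 1 := by
    have : (Finset.univ.filter fun i : Fin (n + m + 1) => i.val ≤ m) =
        Finset.Iic (⟨m, by omega⟩ : Fin (n + m + 1)) := by
      ext i; simp [Fin.le_def]
    rw [this, Fin.card_Iic]
  rw [← h2, h]
  exact Finset.sum_congr rfl fun c _ => by rw [rightMult]

/-- The left ends of the contractions which enclose an energy variable. -/
def enclosing (π : Pairing n m) (i : Fin (n + m + 1)) : Set (Fin (n + m)) :=
  {l | l.val < i.val ∧ i.val ≤ (π.partner l).val}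

theorem enclosing_castSucc (hπ : ¬ π.HasCrossing) (l : Fin (n + m)) :
    π.enclosing l.castSucc = π.enclosing (π.partner l).succ := by
  have cross : ∀ i k : Fin (n + m), i.val < k.val → k.val < (π.partner i).val →
      (π.partner i).val < (π.partner k).val → False := fun i k h1 h2 h3 => hπ ⟨i, k, h1, h2, h3⟩
  ext k
  simp only [enclosing, Set.mem_ofPred_eq, Fin.val_castSucc, Fin.val_succ]
  have hl := π.partner_partner l
  have hk := π.partner_partner k
  have hnl : (π.partner l).val ≠ l.val := fun h => π.ne_self l (Fin.ext h)
  have c1 := cross k l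
  have c2 := cross l k
  have c3 := cross k (π.partner l)
  have c4 := cross (π.partner l) k
  rw [hl] at c3 c4
  by_cases e1 : k = l
  · subst e1; omega
  by_cases e2 : k = π.partner l
  · subst e2; rw [hl]; omega
  have e3 : (π.partner k).val ≠ l.val := fun h => e2 (by rw [← (Fin.ext h : π.partner k = l), hk])
  have e4 : (π.partner k).val ≠ (π.partner l).val := fun h =>
    e1 (π.involutive.injective (Fin.ext h))
  have e1' : k.val ≠ l.val := fun h => e1 (Fin.ext h)
  have e2' : k.val ≠ (π.partner l).val := fun h => e2 (Fin.ext h)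
  constructor
  · rintro ⟨h1, h2⟩
    by_contra h
    rcases lt_or_ge (π.partner k).val (π.partner l).val with h3 | h3
    · exact c1 h1 (by omega) h3
    · exact c4 (by omega) (by omega) (by omega)
  · rintro ⟨h1, h2⟩
    by_contra h
    rcases lt_or_ge l.val k.val with h3 | h3
    · exact c2 (by omega) (by omega) (by omega)
    · exact c3 (by omega) (by omega) (by omega)

variable (π) in
theorem two_mul_card_closers :
    2 * (Finset.univ.filter fun l : Fin (n + m) => π.partner l < l).card = n + m := by
  classical
  have h1 : (Finset.univ.filter fun l : Fin (n + m) => π.partner l < l).card =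
      (Finset.univ.filter fun l : Fin (n + m) => ¬ π.partner l < l).card := by
    refine Finset.card_bij (fun l _ => π.partner l) ?_ ?_ ?_
    · intro l hl
      simp only [Finset.mem_filter, Finset.mem_univ, true_and, partner_partner, not_lt] at hl ⊢
      exact hl.le
    · intro a _ b _ h
      exact π.involutive.injective h
    · intro l hl
      simp only [Finset.mem_filter, Finset.mem_univ, true_and, not_lt] at hl
      refine ⟨π.partner l, ?_, π.partner_partner l⟩
      simp only [Finset.mem_filter, Finset.mem_univ, true_and, partner_partner]
      exact lt_of_le_of_ne hl (π.ne_self l).symm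
  have h2 := Finset.card_filter_add_card_filter_not (s := (Finset.univ : Finset (Fin (n + m))))
    (fun l => π.partner l < l)
  rw [Finset.card_univ, Fintype.card_fin] at h2
  omega

open Classical in
/-- A graph without crossings has `(n + m) / 2` independent variables besides that of `E_n`. -/
theorem two_mul_card_erase_lastClass (hπ : ¬ π.HasCrossing) :
    2 * (Finset.univ.erase π.lastClass).card = n + m := by
  rw [← π.two_mul_card_closers]
  congr 1
  symm
  refine Finset.card_bij (fun l _ => π.classOf l.castSucc) ?_ ?_ ?_
  · intro l hl
    simp only [Finset.mem_filter, Finset.mem_univ, true_and] at hl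
    simp only [Finset.mem_erase, Finset.mem_univ, and_true]
    intro h
    have h1 := π.apply_eq_of_classOf_eq π.enclosing (enclosing_castSucc hπ) h
    have h2 : π.partner l ∈ π.enclosing l.castSucc := by
      simp only [enclosing, Set.mem_ofPred_eq, partner_partner, Fin.val_castSucc, le_refl, and_true]
      exact hl
    rw [h1] at h2
    have := h2.2
    simp at this
    omega
  · intro p hp q hq h
    simp only [Finset.mem_filter, Finset.mem_univ, true_and] at hp hq
    have h1 := π.apply_eq_of_classOf_eq π.enclosing (enclosing_castSucc hπ) h
    have key : ∀ p q : Fin (n + m), π.partner p < p → π.partner q < q →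
        π.enclosing p.castSucc = π.enclosing q.castSucc → π.partner p ≤ π.partner q := by
      intro p q hp hq h1
      have h2 : π.partner p ∈ π.enclosing p.castSucc := by
        simp only [enclosing, Set.mem_ofPred_eq, partner_partner, Fin.val_castSucc, le_refl,
          and_true]
        exact hp
      rw [h1] at h2
      simp only [enclosing, Set.mem_ofPred_eq, partner_partner, Fin.val_castSucc] at h2
      by_contra h3
      have h4 : (p : ℕ) ≠ q := fun h => h3 (by rw [Fin.ext h])
      refine hπ ⟨π.partner q, π.partner p, not_le.1 h3, ?_, ?_⟩
      · rw [partner_partner, Fin.lt_def]; exact h2.1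
      · rw [partner_partner, partner_partner, Fin.lt_def]; omega
    exact π.involutive.injective (le_antisymm (key p q hp hq h1) (key q p hq hp h1.symm))
  · intro c hc
    simp only [Finset.mem_erase, Finset.mem_univ, and_true] at hc
    obtain ⟨i, hi, hmax⟩ := π.exists_isGreatest_class c
    have hlast : i ≠ Fin.last _ := fun h => hc (by rw [← hi, h]; rfl)
    refine ⟨i.castPred hlast, ?_, by simpa using hi⟩
    have := hmax (π.partner (i.castPred hlast)).succ
      (by rw [← classOf_castSucc]; simpa using hi)
    simp only [Finset.mem_filter, Finset.mem_univ, true_and]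
    rw [Fin.le_def] at this
    rw [Fin.lt_def]
    simpa [Nat.succ_le_iff] using this

end Pairing

end TwoSite

namespace TwoSite

/-- The weight `1 / (1 + |u|)`. -/
noncomputable def decay (u : ℝ) : ℝ := 1 / (1 + |u|)

/-- The regularized singularity `1 / (|u| + δ)`. -/
noncomputable def peak (δ u : ℝ) : ℝ := 1 / (|u| + δ)

/-- The integrable majorant `1 / ((|u| + δ) (1 + |u|))`. -/
noncomputable def bump (δ u : ℝ) : ℝ := peak δ u * decay u

/-- The factor `1 + ∫ du / ((|u| + δ) (1 + |u|))`, of order `log (1 / δ)`. -/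
noncomputable def logFactor (δ : ℝ) : ℝ := 1 + ∫ u, bump δ u

theorem decay_pos (u : ℝ) : 0 < decay u := by unfold decay; positivity

theorem decay_le_one (u : ℝ) : decay u ≤ 1 := by
  unfold decay
  rw [div_le_one (by positivity)]
  linarith [abs_nonneg u]

variable {δ : ℝ}

theorem peak_pos (hδ : 0 < δ) (u : ℝ) : 0 < peak δ u := by unfold peak; positivity

theorem peak_le (hδ : 0 < δ) (u : ℝ) : peak δ u ≤ 1 / δ := by
  unfold peak
  gcongr
  linarith [abs_nonneg u]

theorem bump_pos (hδ : 0 < δ) (u : ℝ) : 0 < bump δ u := mul_pos (peak_pos hδ u) (decay_pos u)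

theorem bump_le (hδ : 0 < δ) (u : ℝ) : bump δ u ≤ 1 / δ :=
  (mul_le_of_le_one_right (peak_pos hδ u).le (decay_le_one u)).trans (peak_le hδ u)

theorem bump_abs (u : ℝ) : bump δ |u| = bump δ u := by simp [peak, bump, decay]

theorem continuous_decay : Continuous decay := by
  unfold decay
  exact continuous_const.div (by fun_prop) fun u => by positivity

theorem continuous_peak (hδ : 0 < δ) : Continuous (peak δ) := by
  unfold peak
  exact continuous_const.div (by fun_prop) fun u => by positivity

theorem continuous_bump (hδ : 0 < δ) : Continuous (bump δ) :=
  (continuous_peak hδ).mul continuous_decay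

theorem integrable_bump (hδ : 0 < δ) : Integrable (bump δ) := by
  have h := integrable_inv_one_add_sq.const_mul (2 / δ + 2)
  refine h.mono' (continuous_bump hδ).aestronglyMeasurable (ae_of_all _ fun u => ?_)
  rw [Real.norm_of_nonneg (bump_pos hδ u).le, bump, peak, decay, ← div_eq_mul_inv,
    div_mul_div_comm, one_mul, div_le_div_iff₀ (by positivity) (by positivity)]
  have h1 : 0 ≤ |u| := abs_nonneg u
  have h2 : u ^ 2 = |u| ^ 2 := (sq_abs u).symm
  have h3 : (2 / δ) * δ = 2 := by field_simp
  have h4 : 0 < 2 / δ := by positivity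
  rw [h2]
  nlinarith [mul_nonneg h4.le h1, mul_nonneg (mul_nonneg h4.le h1) h1, mul_nonneg h1 hδ.le]

theorem integral_bump_nonneg (hδ : 0 < δ) : 0 ≤ ∫ u, bump δ u :=
  integral_nonneg fun u => (bump_pos hδ u).le

theorem one_le_logFactor (hδ : 0 < δ) : 1 ≤ logFactor δ := by
  have := integral_bump_nonneg hδ
  unfold logFactor; linarith

theorem integral_bump_le_logFactor : ∫ u, bump δ u ≤ logFactor δ := by
  unfold logFactor; linarith

theorem integral_bump_sub (w : ℝ) : ∫ u, bump δ (u - w) = ∫ u, bump δ u :=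
  integral_sub_right_eq_self _ w

theorem logFactor_le (hδ : 0 < δ) (hδ' : δ ≤ 1 / 2) : logFactor δ ≤ 6 * Real.log (1 / δ) := by
  have hlog : 1 / 2 ≤ Real.log (1 / δ) := by
    have h1 : Real.log 2 ≤ Real.log (1 / δ) :=
      Real.log_le_log (by norm_num) (by rw [le_div_iff₀ hδ]; linarith)
    linarith [Real.log_two_gt_d9]
  have h2 : ∫ u, bump δ u = 2 * ∫ u in Set.Ioi 0, bump δ u := by
    rw [← integral_comp_abs (f := bump δ)]
    simp only [bump_abs]
  have hder : ∀ u ∈ Set.Ici (0 : ℝ), HasDerivAt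
      (fun u => (1 - δ)⁻¹ * (Real.log (u + δ) - Real.log (1 + u))) (bump δ u) u := by
    intro u hu
    have hu' : (0 : ℝ) ≤ u := hu
    have h3 := ((((hasDerivAt_id u).add_const δ).log (by simp; positivity)).sub
      (((hasDerivAt_id u).const_add 1).log (by simp; positivity))).const_mul (1 - δ)⁻¹
    refine HasDerivAt.congr_deriv (f := fun u : ℝ =>
      (1 - δ)⁻¹ * (Real.log (u + δ) - Real.log (1 + u))) h3 ?_
    have : 1 - δ ≠ 0 := by linarith
    simp only [bump, peak, decay, abs_of_nonneg hu', id]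
    field_simp
    ring
  have hlim : Tendsto (fun u : ℝ => (1 - δ)⁻¹ * (Real.log (u + δ) - Real.log (1 + u))) atTop
      (𝓝 ((1 - δ)⁻¹ * 0)) := by
    refine Tendsto.const_mul _ ?_
    have h4 : Tendsto (fun u : ℝ => Real.log (1 + (δ - 1) * (1 + u)⁻¹)) atTop (𝓝 0) := by
      have h5 : Tendsto (fun u : ℝ => 1 + (δ - 1) * (1 + u)⁻¹) atTop (𝓝 (1 + (δ - 1) * 0)) :=
        ((tendsto_inv_atTop_zero.comp (tendsto_atTop_add_const_left _ 1 tendsto_id)).const_mul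
          _).const_add _
      have := h5.log (by norm_num)
      simpa using this
    refine h4.congr' ?_
    filter_upwards [eventually_ge_atTop 0] with u hu
    rw [← Real.log_div (by positivity) (by positivity)]
    congr 1
    field_simp
    ring
  have h6 := integral_Ioi_of_hasDerivAt_of_nonneg' hder
    (fun u _ => (bump_pos hδ u).le) hlim
  rw [logFactor, h2, h6]
  simp only [mul_zero, zero_add, add_zero, Real.log_one, sub_zero, zero_sub]
  have h8 : Real.log (1 / δ) = -Real.log δ := by rw [one_div, Real.log_inv]
  rw [h8] at hlog ⊢
  have h7 : (1 - δ)⁻¹ ≤ 2 := by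
    rw [inv_le_comm₀ (by linarith) (by norm_num)]; linarith
  nlinarith

theorem bump_le_of_mem {ω α : ℝ} (hδ : 0 < δ) (hω : ω ∈ Set.Icc (0 : ℝ) 1) :
    peak δ (α - ω) * decay α ≤ 2 * bump δ (α - ω) := by
  have : decay α ≤ 2 * decay (α - ω) := by
    unfold decay
    rw [mul_one_div, div_le_div_iff₀ (by positivity) (by positivity)]
    have h1 : |α - ω| ≤ |α| + |ω| := abs_sub _ _
    have h2 : |ω| ≤ 1 := abs_le.2 ⟨by linarith [hω.1], hω.2⟩
    linarith [abs_nonneg α]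
  rw [bump]
  have := mul_le_mul_of_nonneg_left this (peak_pos hδ (α - ω)).le
  linarith

theorem peak_le_of_mem {ω α : ℝ} (hδ : 0 < δ) (hω : ω ∈ Set.Icc (0 : ℝ) 1) :
    peak δ (α - ω) ≤ 4 * (decay α * (1 + bump δ (α - ω))) := by
  have h1 : 1 + |α| ≤ 2 * (1 + |α - ω|) := by
    have h1 : |α| ≤ |α - ω| + |ω| := by simpa using abs_add_le (α - ω) ω
    have h2 : |ω| ≤ 1 := abs_le.2 ⟨by linarith [hω.1], hω.2⟩
    linarith [abs_nonneg (α - ω)]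
  set v := |α - ω| with hv
  have hv0 : 0 ≤ v := abs_nonneg _
  have hb : 1 + v ≤ (2 + 2 * (1 / (v + δ) * (1 / (1 + v)))) * (v + δ) := by
    have e : (2 + 2 * (1 / (v + δ) * (1 / (1 + v)))) * (v + δ) =
        2 * (v + δ) + 2 * (1 / (1 + v)) := by field_simp
    rw [e]
    have : 1 - v ≤ 1 / (1 + v) := by
      rw [le_div_iff₀ (by positivity)]; nlinarith
    nlinarith [show 0 ≤ 1 / (1 + v) by positivity]
  unfold bump peak decay
  rw [← hv, div_le_iff₀ (by positivity)]
  have h3 : 4 * (1 / (1 + |α|) * (1 + 1 / (v + δ) * (1 / (1 + v)))) * (v + δ) =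
      2 * ((2 + 2 * (1 / (v + δ) * (1 / (1 + v)))) * (v + δ)) / (1 + |α|) := by
    field_simp
    norm_num
  rw [h3, le_div_iff₀ (by positivity)]
  linarith

theorem decay_mul_peak_le (hδ : 0 < δ) (α β : ℝ) :
    decay α * peak δ (α - β) ≤ bump δ (α - β) + bump δ α := by
  rcases le_total |α - β| |α| with h | h
  · have : decay α ≤ decay (α - β) := by unfold decay; gcongr
    have := mul_le_mul_of_nonneg_right this (peak_pos hδ (α - β)).le
    have h2 := bump_pos hδ α
    rw [bump, mul_comm (peak δ (α - β))]
    linarith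
  · have : peak δ (α - β) ≤ peak δ α := by unfold peak; gcongr
    have := mul_le_mul_of_nonneg_left this (decay_pos α).le
    have h2 := bump_pos hδ (α - β)
    rw [bump, bump, mul_comm (peak δ α)]
    rw [bump] at h2
    linarith

theorem decay_sq_le (hδ : 0 < δ) (hδ' : δ ≤ 1) (α : ℝ) : decay α ^ 2 ≤ bump δ α := by
  rw [sq, bump]
  refine mul_le_mul_of_nonneg_right ?_ (decay_pos α).le
  exact one_div_le_one_div_of_le (by positivity) (by linarith)

theorem decay_sq_mul_peak_le (hδ : 0 < δ) (hδ' : δ ≤ 1) (α β : ℝ) :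
    decay α ^ 2 * peak δ (α - β) ≤ decay β * (bump δ (α - β) + 2 * bump δ α) := by
  have h1 := decay_mul_peak_le hδ α β
  have h2 := decay_sq_le hδ hδ' α
  have h3 : decay α ^ 2 * peak δ (α - β) ≤
      decay β * (decay α * peak δ (α - β) + decay α ^ 2) := by
    have hb : |β| ≤ |α| + |α - β| := by
      have := abs_sub α (α - β); simpa using this
    have h4 : 1 + |β| ≤ (1 + |α|) + (|α - β| + δ) := by linarith
    have e1 : decay α ^ 2 * peak δ (α - β) =
      decay β * ((1 + |β|) * (decay α ^ 2 * peak δ (α - β))) := by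
        unfold decay; field_simp
    rw [e1]
    refine mul_le_mul_of_nonneg_left ?_ (decay_pos β).le
    have h5 : 0 ≤ decay α ^ 2 * peak δ (α - β) :=
      mul_nonneg (sq_nonneg _) (peak_pos hδ _).le
    refine (mul_le_mul_of_nonneg_right h4 h5).trans (le_of_eq ?_)
    unfold decay peak
    have : |α - β| + δ ≠ 0 := by positivity
    field_simp
  refine h3.trans (mul_le_mul_of_nonneg_left ?_ (decay_pos β).le)
  linarith

theorem peak_mul_peak_le (hδ : 0 < δ) (ω α β : ℝ) :
    peak δ (α - ω) * peak δ (β - ω) ≤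
      (peak δ (α - ω) + peak δ (β - ω)) * peak δ (α - β) := by
  have h : |α - β| ≤ |α - ω| + |β - ω| := by
    have := abs_sub (α - ω) (β - ω); simpa using this
  unfold peak
  set x := |α - ω| with hx
  set y := |β - ω| with hy
  have hx0 : 0 ≤ x := abs_nonneg _
  have hy0 : 0 ≤ y := abs_nonneg _
  have e : 1 / (x + δ) + 1 / (y + δ) = (x + δ + (y + δ)) * (1 / (x + δ) * (1 / (y + δ))) := by
    field_simp; ring
  rw [e]
  have h2 : 1 ≤ (x + δ + (y + δ)) * (1 / (|α - β| + δ)) := by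
    rw [mul_one_div, le_div_iff₀ (by positivity)]; linarith
  have h3 : 0 ≤ 1 / (x + δ) * (1 / (y + δ)) := by positivity
  nlinarith

theorem integral_one_add_bump_le (hδ : 0 < δ) (α : ℝ) :
    ∫ ω in (0 : ℝ)..1, (1 + bump δ (α - ω)) ≤ logFactor δ := by
  have hi : Integrable fun ω => bump δ (α - ω) := (integrable_bump hδ).comp_sub_left α
  rw [intervalIntegral.integral_add (by simp) hi.intervalIntegrable, logFactor,
    intervalIntegral.integral_const, sub_zero, one_smul,
    intervalIntegral.integral_of_le zero_le_one]
  refine add_le_add le_rfl ?_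
  rw [← integral_sub_left_eq_self (bump δ) volume α]
  exact setIntegral_le_integral hi (ae_of_all _ fun ω => (bump_pos hδ _).le)

end TwoSite

namespace TwoSite

variable {δ η : ℝ}

theorem prop_denom_ne_zero (hη : 0 < η) (α ω : ℝ) : (ω : ℂ) - α - Complex.I * η ≠ 0 := by
  intro h
  have := congrArg Complex.im h
  simp at this
  exact hη.ne' this

theorem norm_propBar (α η ω : ℝ) : ‖propBar α η ω‖ = ‖prop α η ω‖ := by
  rw [← conj_prop, RCLike.norm_conj]

theorem norm_prop (α η ω : ℝ) : ‖prop α η ω‖ = 1 / ‖(ω : ℂ) - α - Complex.I * η‖ := by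
  simp [prop]

theorem norm_prop_le (hδ : 0 < δ) (hδη : δ ≤ η) (α ω : ℝ) :
    ‖prop α η ω‖ ≤ 2 * peak δ (α - ω) := by
  rw [norm_prop, peak, mul_one_div]
  have h1 := Complex.abs_re_le_norm ((ω : ℂ) - α - Complex.I * η)
  have h2 := Complex.abs_im_le_norm ((ω : ℂ) - α - Complex.I * η)
  simp only [Complex.sub_re, Complex.ofReal_re, Complex.mul_re, Complex.I_re, Complex.I_im,
    Complex.ofReal_im, Complex.sub_im, Complex.mul_im] at h1 h2
  have h3 : |ω - α - (0 * η - 1 * 0)| = |α - ω| := by rw [abs_sub_comm]; simp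
  have h4 : |0 - 0 - (0 * 0 + 1 * η)| = η := by
    rw [show (0 : ℝ) - 0 - (0 * 0 + 1 * η) = -η by ring, abs_neg, abs_of_pos (hδ.trans_le hδη)]
  rw [h3] at h1
  rw [h4] at h2
  have h5 : 0 < |α - ω| + δ := by positivity
  rw [div_le_div_iff₀ (by linarith [abs_nonneg (α - ω)]) h5]
  linarith

theorem norm_prop_le_inv (hδ : 0 < δ) (hδη : δ ≤ η) (α ω : ℝ) : ‖prop α η ω‖ ≤ 1 / δ := by
  rw [norm_prop]
  have h2 := Complex.abs_im_le_norm ((ω : ℂ) - α - Complex.I * η)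
  simp only [Complex.ofReal_re, Complex.I_re, Complex.I_im,
    Complex.ofReal_im, Complex.sub_im, Complex.mul_im] at h2
  have h4 : |0 - 0 - (0 * 0 + 1 * η)| = η := by
    rw [show (0 : ℝ) - 0 - (0 * 0 + 1 * η) = -η by ring, abs_neg, abs_of_pos (hδ.trans_le hδη)]
  rw [h4] at h2
  exact one_div_le_one_div_of_le hδ (hδη.trans h2)

theorem continuous_prop {X : Type*} [TopologicalSpace X] {f g : X → ℝ} (hη : 0 < η)
    (hf : Continuous f) (hg : Continuous g) : Continuous fun x => prop (f x) η (g x) := by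
  unfold prop
  exact continuous_const.div (by fun_prop) fun p => prop_denom_ne_zero hη _ _

theorem continuous_prop_right (hη : 0 < η) (α : ℝ) : Continuous fun ω => prop α η ω :=
  continuous_prop hη continuous_const continuous_id

theorem continuous_propBar {X : Type*} [TopologicalSpace X] {f g : X → ℝ} (hη : 0 < η)
    (hf : Continuous f) (hg : Continuous g) : Continuous fun x => propBar (f x) η (g x) := by
  simp only [← conj_prop]
  exact Complex.continuous_conj.comp (continuous_prop hη hf hg)

theorem integral_norm_prop_le (hδ : 0 < δ) (hδη : δ ≤ η) (α : ℝ) :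
    ∫ ω in (0 : ℝ)..1, ‖prop α η ω‖ ≤ 8 * logFactor δ * decay α := by
  have hη := hδ.trans_le hδη
  have hc : Continuous fun ω => 8 * decay α * (1 + bump δ (α - ω)) := by
    have := continuous_bump hδ
    fun_prop
  calc ∫ ω in (0 : ℝ)..1, ‖prop α η ω‖
      ≤ ∫ ω in (0 : ℝ)..1, 8 * decay α * (1 + bump δ (α - ω)) := by
        refine intervalIntegral.integral_mono_on zero_le_one
          (continuous_prop_right hη α).norm.continuousOn.intervalIntegrable
          hc.continuousOn.intervalIntegrable fun ω hω => ?_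
        linarith [norm_prop_le hδ hδη α ω, peak_le_of_mem (α := α) hδ hω]
    _ ≤ _ := by
        rw [intervalIntegral.integral_const_mul]
        have := mul_le_mul_of_nonneg_left (integral_one_add_bump_le hδ α)
          (mul_nonneg (by norm_num : (0 : ℝ) ≤ 8) (decay_pos α).le)
        linarith

/-- The absolute rung integral `∫₀¹ dω |ω - α - iη|⁻¹ |ω - β - iη|⁻¹`. -/
noncomputable def rung (η α β : ℝ) : ℝ := ∫ ω in (0 : ℝ)..1, ‖prop α η ω‖ * ‖prop β η ω‖

theorem rung_comm (η α β : ℝ) : rung η α β = rung η β α := by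
  simp only [rung, mul_comm]

theorem rung_nonneg (η α β : ℝ) : 0 ≤ rung η α β :=
  intervalIntegral.integral_nonneg zero_le_one fun _ _ => by positivity

theorem rung_le_div (hδ : 0 < δ) (hδη : δ ≤ η) (α β : ℝ) :
    rung η α β ≤ 8 * logFactor δ * (1 / δ) := by
  have hη := hδ.trans_le hδη
  have hL := one_le_logFactor hδ
  calc rung η α β ≤ ∫ ω in (0 : ℝ)..1, ‖prop α η ω‖ * (1 / δ) := by
        refine intervalIntegral.integral_mono_on zero_le_one
          ((continuous_prop_right hη α).norm.mul
            (continuous_prop_right hη β).norm).continuousOn.intervalIntegrable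
          ((continuous_prop_right hη α).norm.mul continuous_const).continuousOn.intervalIntegrable
          fun ω hω => ?_
        exact mul_le_mul_of_nonneg_left (norm_prop_le_inv hδ hδη β ω) (norm_nonneg _)
    _ ≤ _ := by
        rw [intervalIntegral.integral_mul_const]
        refine mul_le_mul_of_nonneg_right ?_ (by positivity)
        refine (integral_norm_prop_le hδ hδη α).trans ?_
        exact mul_le_of_le_one_right (by positivity) (decay_le_one α)

theorem rung_le (hδ : 0 < δ) (hδη : δ ≤ η) (α β : ℝ) :
    rung η α β ≤ 16 * logFactor δ * (peak δ (α - β) * (decay α + decay β)) := by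
  have hη := hδ.trans_le hδη
  have hb := continuous_bump hδ
  have i1 : ∀ α, IntervalIntegrable (fun ω => decay α * (1 + bump δ (α - ω))) volume 0 1 :=
    fun α => Continuous.intervalIntegrable (by fun_prop) _ _
  calc rung η α β
      ≤ ∫ ω in (0 : ℝ)..1, 16 * peak δ (α - β) *
        (decay α * (1 + bump δ (α - ω)) + decay β * (1 + bump δ (β - ω))) := by
        refine intervalIntegral.integral_mono_on zero_le_one
          ((continuous_prop_right hη α).norm.mul
            (continuous_prop_right hη β).norm).continuousOn.intervalIntegrable
          (Continuous.intervalIntegrable (by fun_prop) _ _)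
          fun ω hω => ?_
        have h1 := mul_le_mul (norm_prop_le hδ hδη α ω) (norm_prop_le hδ hδη β ω)
          (norm_nonneg _) (mul_nonneg zero_le_two (peak_pos hδ _).le)
        have h2 := peak_mul_peak_le hδ ω α β
        have h3 := mul_le_mul_of_nonneg_right (add_le_add (peak_le_of_mem (α := α) hδ hω)
          (peak_le_of_mem (α := β) hδ hω)) (peak_pos hδ (α - β)).le
        linarith
    _ ≤ _ := by
        rw [intervalIntegral.integral_const_mul, intervalIntegral.integral_add (i1 α) (i1 β),
          intervalIntegral.integral_const_mul, intervalIntegral.integral_const_mul]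
        have h1 := mul_le_mul_of_nonneg_left (integral_one_add_bump_le hδ α) (decay_pos α).le
        have h2 := mul_le_mul_of_nonneg_left (integral_one_add_bump_le hδ β) (decay_pos β).le
        have h3 := mul_le_mul_of_nonneg_left (add_le_add h1 h2)
          (mul_nonneg (by norm_num : (0 : ℝ) ≤ 16) (peak_pos hδ (α - β)).le)
        linarith

/-- An integrable majorant on the plane of the last propagator times one rung integral. -/
noncomputable def majorant (δ w α β : ℝ) : ℝ :=
  bump δ (β - w) * (2 * bump δ (α - β) + 3 * bump δ α)

theorem majorant_nonneg (hδ : 0 < δ) (w α β : ℝ) : 0 ≤ majorant δ w α β := by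
  have h1 := bump_pos hδ (β - w)
  have h2 := bump_pos hδ (α - β)
  have h3 := bump_pos hδ α
  unfold majorant; positivity

theorem decay_mul_norm_prop_mul_rung_le (hδ : 0 < δ) (hδ' : δ ≤ 1) (hδη : δ ≤ η) {w : ℝ}
    (hw : w ∈ Set.Icc (0 : ℝ) 1) (α β : ℝ) :
    decay α * ‖prop β η w‖ * rung η α β ≤ 64 * logFactor δ * majorant δ w α β := by
  have hL := one_le_logFactor hδ
  have hp := (peak_pos hδ (β - w)).le
  have h1 : decay α * ‖prop β η w‖ * rung η α β ≤ decay α * (2 * peak δ (β - w)) *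
      (16 * logFactor δ * (peak δ (α - β) * (decay α + decay β))) :=
    mul_le_mul (mul_le_mul_of_nonneg_left (norm_prop_le hδ hδη β w) (decay_pos α).le)
      (rung_le hδ hδη α β) (rung_nonneg _ _ _) (mul_nonneg (decay_pos α).le (by positivity))
  have h2 := decay_sq_mul_peak_le hδ hδ' α β
  have h3 := mul_le_mul_of_nonneg_left (decay_mul_peak_le hδ α β) (decay_pos β).le
  have h4 := bump_le_of_mem (α := β) hδ hw
  have h5 : decay α ^ 2 * peak δ (α - β) + decay β * (decay α * peak δ (α - β)) ≤
      decay β * (2 * bump δ (α - β) + 3 * bump δ α) := by linarith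
  have h6 := mul_le_mul_of_nonneg_left h5
    (mul_nonneg (mul_nonneg (by norm_num : (0 : ℝ) ≤ 32) (zero_le_one.trans hL)) hp)
  have h7 : 0 ≤ 32 * logFactor δ * (2 * bump δ (α - β) + 3 * bump δ α) := by
    have h2 := bump_pos hδ (α - β)
    have h3 := bump_pos hδ α
    positivity
  have h8 := mul_le_mul_of_nonneg_left h4 h7
  unfold majorant
  linarith

theorem integrable_majorant (hδ : 0 < δ) (w : ℝ) :
    Integrable (fun p : ℝ × ℝ => majorant δ w p.1 p.2) := by
  have h0 := integrable_bump hδ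
  have h1 : Integrable (fun β => bump δ (β - w)) := h0.comp_sub_right w
  have h2 : Integrable (fun p : ℝ × ℝ => bump δ p.1 * bump δ (p.2 - w)) := h0.mul_prod h1
  have h3 := Integrable.convolution_integrand (ContinuousLinearMap.mul ℝ ℝ) h1 h0
  simp only [ContinuousLinearMap.mul_apply'] at h3
  refine ((h3.const_mul 2).add (h2.const_mul 3)).congr (ae_of_all _ fun p => ?_)
  simp only [majorant, Pi.add_apply]
  ring

theorem integral_majorant_le (hδ : 0 < δ) (w : ℝ) :
    ∫ p : ℝ × ℝ, majorant δ w p.1 p.2 ≤ 5 * logFactor δ ^ 2 := by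
  have h0 := integrable_bump hδ
  have h : ∫ p : ℝ × ℝ, majorant δ w p.1 p.2 = 5 * (∫ u, bump δ u) ^ 2 := by
    have hi := integrable_majorant hδ w
    rw [Measure.volume_eq_prod] at hi ⊢
    rw [integral_prod_symm _ hi]
    have : ∀ β, ∫ α, majorant δ w α β = bump δ (β - w) * (5 * ∫ u, bump δ u) := fun β => by
      simp only [majorant]
      rw [integral_const_mul, integral_add ((h0.comp_sub_right β).const_mul 2) (h0.const_mul 3),
        integral_const_mul, integral_const_mul, integral_bump_sub]
      ring
    simp only [this]
    rw [integral_mul_const, integral_bump_sub]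
    ring
  rw [h]
  have := integral_bump_nonneg hδ
  have h2 := integral_bump_le_logFactor (δ := δ)
  gcongr

theorem norm_selfEnergy_le (hδ : 0 < δ) (hδη : δ ≤ η) (α : ℝ) :
    ‖selfEnergy α η‖ ≤ 8 * logFactor δ * decay α :=
  (intervalIntegral.norm_integral_le_integral_norm zero_le_one).trans
    (integral_norm_prop_le hδ hδη α)

theorem norm_classIntegral_le (hδ : 0 < δ) (hδη : δ ≤ η) (α β : ℝ) {k p : ℕ} (hk : 1 ≤ k)
    (hp : 1 ≤ p) :
    ‖classIntegral α β η k p‖ ≤ (1 / δ) ^ (k - 1 + (p - 1)) * rung η α β := by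
  have hη := hδ.trans_le hδη
  obtain ⟨k, rfl⟩ := Nat.exists_eq_add_of_le' hk
  obtain ⟨p, rfl⟩ := Nat.exists_eq_add_of_le' hp
  rw [rung, ← intervalIntegral.integral_const_mul]
  refine intervalIntegral.norm_integral_le_of_norm_le zero_le_one (ae_of_all _ fun ω _ => ?_)
    (Continuous.intervalIntegrable (continuous_const.mul
      ((continuous_prop_right hη α).norm.mul (continuous_prop_right hη β).norm)) _ _)
  rw [norm_mul, norm_pow, norm_pow, norm_propBar, pow_succ, pow_succ, Nat.add_sub_cancel,
    Nat.add_sub_cancel, pow_add]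
  have h1 := pow_le_pow_left₀ (norm_nonneg _) (norm_prop_le_inv hδ hδη α ω) k
  have h2 := pow_le_pow_left₀ (norm_nonneg _) (norm_prop_le_inv hδ hδη β ω) p
  calc _ = ‖prop α η ω‖ ^ k * ‖prop β η ω‖ ^ p * (‖prop α η ω‖ * ‖prop β η ω‖) := by ring
    _ ≤ _ := by gcongr

theorem norm_classIntegral_le_pow (hδ : 0 < δ) (hδη : δ ≤ η) (α β : ℝ) (k p : ℕ) :
    ‖classIntegral α β η k p‖ ≤ (1 / δ) ^ (k + p) := by
  have h : ∀ ω ∈ Set.uIoc (0 : ℝ) 1,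
      ‖prop α η ω ^ k * propBar β η ω ^ p‖ ≤ (1 / δ) ^ (k + p) := fun ω _ => by
    rw [norm_mul, norm_pow, norm_pow, norm_propBar, pow_add]
    have h1 := pow_le_pow_left₀ (norm_nonneg _) (norm_prop_le_inv hδ hδη α ω) k
    have h2 := pow_le_pow_left₀ (norm_nonneg _) (norm_prop_le_inv hδ hδη β ω) p
    gcongr
  have := intervalIntegral.norm_integral_le_of_norm_le_const h
  rwa [sub_zero, abs_one, mul_one] at this

theorem continuous_classIntegral (hη : 0 < η) (k p : ℕ) :
    Continuous fun q : ℝ × ℝ => classIntegral q.1 q.2 η k p := by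
  unfold classIntegral
  refine intervalIntegral.continuous_parametric_intervalIntegral_of_continuous' ?_ 0 1
  exact ((continuous_prop hη (by fun_prop) (by fun_prop)).pow k).mul
    ((continuous_propBar hη (by fun_prop) (by fun_prop)).pow p)

theorem continuous_selfEnergy (hη : 0 < η) : Continuous fun α => selfEnergy α η := by
  have := (continuous_classIntegral hη 1 0).comp
    (by fun_prop : Continuous fun α : ℝ => (α, (0 : ℝ)))
  simpa [Function.comp_def, classIntegral_one_zero] using this

/-- The explicit boundary value of the self-energy. -/
noncomputable def logSelfEnergy (w : ℝ) : ℂ :=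
  Complex.log w - Complex.log (1 - w) - Real.pi * Complex.I

theorem selfEnergy_eq_log (hη : 0 < η) (α : ℝ) :
    selfEnergy α η = Complex.log (α + Complex.I * η) - Complex.log (1 - α - Complex.I * η) -
      Real.pi * Complex.I := by
  have hd : ∀ ω ∈ Set.uIcc (0 : ℝ) 1, HasDerivAt
      (fun ω : ℝ => -Complex.log ((ω : ℂ) - α - Complex.I * η)) (prop α η ω) ω := by
    intro ω _
    have h1 : HasDerivAt (fun ω : ℝ => (ω : ℂ) - α - Complex.I * η) 1 ω :=
      ((Complex.ofRealCLM.hasDerivAt (x := ω)).sub_const (α : ℂ)).sub_const _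
    have h2 : (ω : ℂ) - α - Complex.I * η ∈ Complex.slitPlane := by
      right
      simp
      exact hη.ne'
    have := (h1.clog_real h2).neg
    rw [← neg_div] at this
    exact this
  have h := intervalIntegral.integral_eq_sub_of_hasDerivAt hd
    ((continuous_prop_right hη α).intervalIntegrable _ _)
  rw [selfEnergy, h]
  have h3 : Complex.log (((0 : ℝ) : ℂ) - α - Complex.I * η) =
      Complex.log (α + Complex.I * η) - Real.pi * Complex.I := by
    rw [show ((0 : ℝ) : ℂ) - α - Complex.I * η = -(α + Complex.I * η) by push_cast; ring,
      Complex.log, Complex.log, norm_neg, Complex.arg_neg_eq_arg_sub_pi_of_im_pos (by simpa)]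
    push_cast
    ring
  rw [h3]
  push_cast
  ring

theorem tendsto_selfEnergy {w : ℝ} (hw : w ∈ Set.Ioo (0 : ℝ) 1) :
    Tendsto (fun η => selfEnergy w η) (𝓝[>] 0) (𝓝 (logSelfEnergy w)) := by
  have h : Tendsto (fun η : ℝ => Complex.log (w + Complex.I * η) -
      Complex.log (1 - w - Complex.I * η) - Real.pi * Complex.I) (𝓝 0)
      (𝓝 (logSelfEnergy w)) := by
    have h1 : Tendsto (fun η : ℝ => (w : ℂ) + Complex.I * η) (𝓝 0) (𝓝 w) := by
      have : Continuous fun η : ℝ => (w : ℂ) + Complex.I * η := by fun_prop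
      simpa using this.tendsto 0
    have h2 : Tendsto (fun η : ℝ => 1 - (w : ℂ) - Complex.I * η) (𝓝 0) (𝓝 (1 - w)) := by
      have : Continuous fun η : ℝ => 1 - (w : ℂ) - Complex.I * η := by fun_prop
      simpa using this.tendsto 0
    refine ((h1.clog ?_).sub (h2.clog ?_)).sub_const _
    · exact Or.inl (by simpa using hw.1)
    · exact Or.inl (by simpa using hw.2)
  refine (h.mono_left nhdsWithin_le_nhds).congr' ?_
  filter_upwards [self_mem_nhdsWithin] with η hη
  exact (selfEnergy_eq_log hη w).symm

theorem boundarySelfEnergy_eq {w : ℝ} (hw : w ∈ Set.Ioo (0 : ℝ) 1) :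
    boundarySelfEnergy w = logSelfEnergy w :=
  (tendsto_selfEnergy hw).limUnder_eq

theorem norm_clog_sub_clog_le {ε : ℝ} (hε : 0 < ε) {x y : ℂ} (hx : ε ≤ x.re) (hy : ε ≤ y.re) :
    ‖Complex.log y - Complex.log x‖ ≤ 1 / ε * ‖y - x‖ := by
  refine Convex.norm_image_sub_le_of_norm_hasDerivWithin_le (s := {z : ℂ | ε ≤ z.re})
    (f' := fun z => z⁻¹) (fun z hz => ?_) (fun z hz => ?_) (convex_halfSpace_re_ge ε) hx hy
  · exact (Complex.hasDerivAt_log (Or.inl (hε.trans_le hz))).hasDerivWithinAt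
  · rw [norm_inv, ← one_div]
    exact one_div_le_one_div_of_le hε (le_trans hz ((le_abs_self _).trans
      (Complex.abs_re_le_norm z)))

theorem norm_clog_ofReal_le {ε w : ℝ} (hε : 0 < ε) (h : ε ≤ w) (hw : w ≤ 1) :
    ‖Complex.log w‖ ≤ 1 / ε := by
  have hε1 : ε ≤ 1 := h.trans hw
  have h1 := norm_clog_sub_clog_le hε (x := 1) (y := w) (by simpa) (by simpa)
  rw [Complex.log_one, sub_zero] at h1
  refine h1.trans (mul_le_of_le_one_right (by positivity) ?_)
  rw [← Complex.ofReal_one, ← Complex.ofReal_sub, Complex.norm_real, Real.norm_eq_abs, abs_le]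
  constructor <;> linarith

theorem norm_logSelfEnergy_le {ε w : ℝ} (hε : 0 < ε) (hw : w ∈ Set.Ioo ε (1 - ε)) :
    ‖logSelfEnergy w‖ ≤ 2 / ε + 4 := by
  have h1 := norm_clog_ofReal_le hε hw.1.le (by linarith [hw.2])
  have h2 := norm_clog_ofReal_le (w := 1 - w) hε (by linarith [hw.2]) (by linarith [hw.1])
  have h3 : ‖(Real.pi : ℂ) * Complex.I‖ ≤ 4 := by
    rw [norm_mul, Complex.norm_I, mul_one, Complex.norm_real, Real.norm_of_nonneg Real.pi_pos.le]
    exact Real.pi_le_four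
  rw [Complex.ofReal_sub, Complex.ofReal_one] at h2
  refine (norm_sub_le _ _).trans ((add_le_add (norm_sub_le _ _) le_rfl).trans ?_)
  have : 2 / ε = 1 / ε + 1 / ε := by ring
  linarith

/-- The replacement of the self-energy by its boundary value cancels one propagator. -/
theorem norm_prop_mul_norm_selfEnergy_sub_le {ε : ℝ} (hε : 0 < ε) (hδ : 0 < δ) (hδη : δ ≤ η)
    {w : ℝ} (hw : w ∈ Set.Ioo ε (1 - ε)) (α : ℝ) :
    ‖prop α η w‖ * ‖selfEnergy α η - logSelfEnergy w‖ ≤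
      (2 / ε + 12) * (2 + 4 / ε) * logFactor δ * decay α := by
  have hη := hδ.trans_le hδη
  have hL := one_le_logFactor hδ
  have hε2 : ε < 1 / 2 := by linarith [hw.1, hw.2]
  have hwa : |w| ≤ 1 := abs_le.2 ⟨by linarith [hw.1], by linarith [hw.2]⟩
  have h1a : |α| ≤ |α - w| + |w| := by simpa using abs_add_le (α - w) w
  rcases le_or_gt (ε / 2) |α - w| with h | h
  · have h1 : ‖prop α η w‖ ≤ (2 + 4 / ε) * decay α := by
      rw [norm_prop, decay, mul_one_div]
      have h2 := Complex.abs_re_le_norm ((w : ℂ) - α - Complex.I * η)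
      have h3 : ((w : ℂ) - α - Complex.I * η).re = w - α := by simp
      rw [h3, abs_sub_comm] at h2
      rw [div_le_div_iff₀ (by linarith) (by positivity)]
      have h4 : 2 ≤ 4 / ε * |α - w| := by
        rw [div_mul_eq_mul_div, le_div_iff₀ hε]; linarith
      have h5 : 0 < 2 + 4 / ε := by positivity
      have h6 := mul_le_mul_of_nonneg_left h2 h5.le
      linarith [abs_nonneg (α - w)]
    have h2 : ‖selfEnergy α η - logSelfEnergy w‖ ≤ (2 / ε + 12) * logFactor δ := by
      refine (norm_sub_le _ _).trans ?_
      have h3 := norm_selfEnergy_le hδ hδη α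
      have h4 := norm_logSelfEnergy_le hε hw
      have h5 : 8 * logFactor δ * decay α ≤ 8 * logFactor δ :=
        mul_le_of_le_one_right (by positivity) (decay_le_one α)
      have h6 : 2 / ε + 4 ≤ (2 / ε + 4) * logFactor δ :=
        le_mul_of_one_le_right (by positivity) hL
      linarith
    have := mul_le_mul h1 h2 (norm_nonneg _) (mul_nonneg (by positivity) (decay_pos α).le)
    linarith
  · have hb := abs_lt.1 h
    have h1 : ‖selfEnergy α η - logSelfEnergy w‖ ≤ 4 / ε * ‖(w : ℂ) - α - Complex.I * η‖ := by
      rw [selfEnergy_eq_log hη, logSelfEnergy]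
      have h2 := norm_clog_sub_clog_le (ε := ε / 2) (by positivity) (x := (w : ℂ))
        (y := α + Complex.I * η) (by simp; linarith [hw.1]) (by simp; linarith [hw.1])
      have h3 := norm_clog_sub_clog_le (ε := ε / 2) (by positivity) (x := 1 - (w : ℂ))
        (y := 1 - α - Complex.I * η) (by simp; linarith [hw.2]) (by simp; linarith [hw.2])
      have e2 : ‖(1 : ℂ) - α - Complex.I * η - (1 - w)‖ = ‖(w : ℂ) - α - Complex.I * η‖ := by
        congr 1; ring
      rw [e2] at h3
      have e3 : ‖(α : ℂ) + Complex.I * η - w‖ = ‖(w : ℂ) - α - Complex.I * η‖ := by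
        rw [← norm_neg]; congr 1; ring
      rw [e3] at h2
      calc _ = ‖(Complex.log (α + Complex.I * η) - Complex.log w) -
            (Complex.log (1 - α - Complex.I * η) - Complex.log (1 - w))‖ := by
            congr 1; ring
        _ ≤ _ := by
            refine (norm_sub_le _ _).trans ((add_le_add h2 h3).trans (le_of_eq ?_))
            field_simp
            ring
    have h2 : ‖prop α η w‖ * ‖(w : ℂ) - α - Complex.I * η‖ = 1 := by
      rw [norm_prop]
      have := norm_ne_zero_iff.2 (prop_denom_ne_zero hη α w)
      field_simp
    have h3 : ‖prop α η w‖ * ‖selfEnergy α η - logSelfEnergy w‖ ≤ 4 / ε := by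
      have := mul_le_mul_of_nonneg_left h1 (norm_nonneg (prop α η w))
      calc _ ≤ _ := this
        _ = 4 / ε * (‖prop α η w‖ * ‖(w : ℂ) - α - Complex.I * η‖) := by ring
        _ = _ := by rw [h2, mul_one]
    refine h3.trans ?_
    have h4 : 1 ≤ 3 * decay α := by
      rw [decay, mul_one_div, le_div_iff₀ (by positivity)]; linarith
    have h5 : 4 / ε ≤ (2 / ε + 12) * (2 + 4 / ε) / 3 := by
      have : 0 < 1 / ε := by positivity
      have e1 : 4 / ε = 4 * (1 / ε) := by ring
      have e2 : 2 / ε = 2 * (1 / ε) := by ring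
      rw [e1, e2]
      nlinarith
    calc 4 / ε ≤ (2 / ε + 12) * (2 + 4 / ε) / 3 := h5
      _ ≤ (2 / ε + 12) * (2 + 4 / ε) / 3 * (logFactor δ * (3 * decay α)) :=
        le_mul_of_one_le_right (by positivity) (one_le_mul_of_one_le_of_one_le hL h4)
      _ = _ := by ring

end TwoSite

namespace TwoSite

section Square

variable {F : ℝ × ℝ → ℂ}

theorem square_integral_eq (hF : Integrable F) {R : ℝ} (hR : 0 ≤ R) :
    ∫ α in (-R)..R, ∫ β in (-R)..R, F (α, β) =
      ∫ p in Set.Ioc (-R) R ×ˢ Set.Ioc (-R) R, F p := by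
  have hle : -R ≤ R := by linarith
  rw [Measure.volume_eq_prod] at hF ⊢
  rw [setIntegral_prod _ hF.integrableOn]
  simp only [intervalIntegral.integral_of_le hle]

theorem norm_square_integral_le (hF : Integrable F) {R : ℝ} (hR : 0 ≤ R) :
    ‖∫ α in (-R)..R, ∫ β in (-R)..R, F (α, β)‖ ≤ ∫ p, ‖F p‖ := by
  rw [square_integral_eq hF hR]
  exact (norm_integral_le_integral_norm _).trans
    (setIntegral_le_integral hF.norm (ae_of_all _ fun _ => norm_nonneg _))

theorem tendsto_square_integral (hF : Integrable F) :
    Tendsto (fun R : ℝ => ∫ α in (-R)..R, ∫ β in (-R)..R, F (α, β)) atTop (𝓝 (∫ p, F p)) := by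
  have hc : AECover volume atTop
      (fun R : ℝ => Set.Ioc (-R) R ×ˢ Set.Ioc (-R) R : ℝ → Set (ℝ × ℝ)) := by
    refine ⟨ae_of_all _ fun p => ?_, fun R => measurableSet_Ioc.prod measurableSet_Ioc⟩
    filter_upwards [eventually_gt_atTop |p.1|, eventually_gt_atTop |p.2|] with R h1 h2
    exact ⟨⟨(abs_lt.1 h1).1, (abs_lt.1 h1).2.le⟩, ⟨(abs_lt.1 h2).1, (abs_lt.1 h2).2.le⟩⟩
  refine (hc.integral_tendsto_of_countably_generated hF).congr' ?_
  filter_upwards [eventually_ge_atTop 0] with R hR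
  exact (square_integral_eq hF hR).symm

theorem norm_interval_integral_le {f : ℝ → ℂ} {g : ℝ → ℝ} (hg : Integrable g)
    (hfg : ∀ x, ‖f x‖ ≤ g x) {R : ℝ} (hR : 0 ≤ R) :
    ‖∫ α in (-R)..R, f α‖ ≤ ∫ x, g x := by
  have hle : -R ≤ R := by linarith
  refine (intervalIntegral.norm_integral_le_of_norm_le hle (ae_of_all _ fun x _ => hfg x)
    hg.intervalIntegrable).trans ?_
  rw [intervalIntegral.integral_of_le hle]
  exact setIntegral_le_integral hg (ae_of_all _ fun x => (norm_nonneg _).trans (hfg x))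

theorem tendsto_symm_interval_integral {f : ℝ → ℂ} (hf : Integrable f) :
    Tendsto (fun R : ℝ => ∫ α in (-R)..R, f α) atTop (𝓝 (∫ α, f α)) :=
  intervalIntegral_tendsto_integral hf tendsto_neg_atTop_atBot tendsto_id

end Square

theorem norm_pow_sub_pow_le {M : ℝ} (hM : 1 ≤ M) {x y : ℂ} (hx : ‖x‖ ≤ M) (hy : ‖y‖ ≤ M)
    (a : ℕ) : ‖x ^ a - y ^ a‖ ≤ (2 * M) ^ a * ‖x - y‖ := by
  induction a with
  | zero => simp
  | succ a ih =>
    have e : x ^ (a + 1) - y ^ (a + 1) = x * (x ^ a - y ^ a) + (x - y) * y ^ a := by ring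
    rw [e]
    refine (norm_add_le _ _).trans ?_
    rw [norm_mul, norm_mul, norm_pow]
    have h1 : ‖y‖ ^ a ≤ (2 * M) ^ a := pow_le_pow_left₀ (norm_nonneg _) (by linarith) a
    have h2 := mul_le_mul hx ih (norm_nonneg _) (by linarith)
    have h3 := mul_le_mul_of_nonneg_left h1 (norm_nonneg (x - y))
    have h4 : 0 ≤ (2 * M) ^ a * ‖x - y‖ := by positivity
    rw [pow_succ]
    nlinarith

variable {δ : ℝ}

section OneVariable

variable {η : ℝ}

theorem norm_prop_sq_le (hδ : 0 < δ) (hδ' : δ ≤ 1) (hδη : δ ≤ η) {w : ℝ}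
    (hw : w ∈ Set.Icc (0 : ℝ) 1) (α : ℝ) :
    ‖prop α η w‖ ^ 2 ≤ 64 * (1 / δ) * bump δ (α - w) := by
  have hN : 1 ≤ 1 / δ := by rw [le_div_iff₀ hδ]; linarith
  have h1 := norm_prop_le hδ hδη α w
  have h2 := peak_le_of_mem (α := α) hδ hw
  have h3 := bump_le_of_mem (α := α) hδ hw
  have h4 := bump_le hδ (α - w)
  have hp := peak_pos hδ (α - w)
  have hb := bump_pos hδ (α - w)
  have hd := decay_pos α
  calc ‖prop α η w‖ ^ 2 ≤ (2 * peak δ (α - w)) ^ 2 := pow_le_pow_left₀ (norm_nonneg _) h1 2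
    _ = 4 * peak δ (α - w) * peak δ (α - w) := by ring
    _ ≤ 4 * peak δ (α - w) * (4 * (decay α * (1 + bump δ (α - w)))) := by gcongr
    _ = 16 * (peak δ (α - w) * decay α) * (1 + bump δ (α - w)) := by ring
    _ ≤ 16 * (2 * bump δ (α - w)) * (1 / δ + 1 / δ) := by gcongr
    _ = _ := by ring

theorem norm_prop_le_decay (hδ : 0 < δ) (hδ' : δ ≤ 1) (hδη : δ ≤ η) {w : ℝ}
    (hw : w ∈ Set.Icc (0 : ℝ) 1) (α : ℝ) : ‖prop α η w‖ ≤ 16 * (1 / δ) * decay α := by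
  have hN : 1 ≤ 1 / δ := by rw [le_div_iff₀ hδ]; linarith
  have h1 := norm_prop_le hδ hδη α w
  have h2 := peak_le_of_mem (α := α) hδ hw
  have h4 := bump_le hδ (α - w)
  have hd := decay_pos α
  nlinarith

theorem norm_prop_mul_decay_le (hδ : 0 < δ) (hδη : δ ≤ η) {w : ℝ}
    (hw : w ∈ Set.Icc (0 : ℝ) 1) (α : ℝ) : ‖prop α η w‖ * decay α ≤ 4 * bump δ (α - w) := by
  have h1 := mul_le_mul_of_nonneg_right (norm_prop_le hδ hδη α w) (decay_pos α).le
  have h3 := bump_le_of_mem (α := α) hδ hw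
  linarith

theorem integral_const_mul_bump_le {c : ℝ} (hc : 0 ≤ c) (w : ℝ) :
    ∫ α, c * bump δ (α - w) ≤ c * logFactor δ := by
  rw [integral_const_mul, integral_bump_sub]
  exact mul_le_mul_of_nonneg_left integral_bump_le_logFactor hc

end OneVariable

/-- The truncated `α`-integral of a power of the propagator against a function `g`. -/
noncomputable def oscInt (t w : ℝ) (K : ℕ) (g : ℝ → ℂ) (R : ℝ) : ℂ :=
  ∫ α in (-R)..R, Complex.exp (-Complex.I * α * t) * (prop α t⁻¹ w ^ K * g α)

theorem norm_exp_osc (α t : ℝ) : ‖Complex.exp (-Complex.I * α * t)‖ = 1 := by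
  rw [Complex.norm_exp]
  simp

theorem oscInt_one (ht : 0 < t) (w R : ℝ) :
    oscInt t w 1 1 R = Complex.I / t * (Complex.exp (-Complex.I * (R : ℝ) * t) * prop R t⁻¹ w -
      Complex.exp (-Complex.I * (-R : ℝ) * t) * prop (-R) t⁻¹ w) +
      Complex.I / t * oscInt t w 2 1 R := by
  have ht' : (0 : ℝ) < t⁻¹ := inv_pos.2 ht
  have htc : (t : ℂ) ≠ 0 := by exact_mod_cast ht.ne'
  have hce : Continuous fun α : ℝ => Complex.exp (-Complex.I * α * t) := by fun_prop
  have hcp : Continuous fun α : ℝ => prop α t⁻¹ w :=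
    continuous_prop ht' continuous_id continuous_const
  have hu : ∀ α : ℝ, HasDerivAt (fun α : ℝ => prop α t⁻¹ w) (-prop α t⁻¹ w ^ 2) α := by
    intro α
    have h1 : HasDerivAt (fun α : ℝ => (w : ℂ) - α - Complex.I * (t⁻¹ : ℝ)) (-1) α :=
      ((Complex.ofRealCLM.hasDerivAt (x := α)).const_sub (w : ℂ)).sub_const _
    have h2 := (h1.inv (prop_denom_ne_zero ht' α w)).const_mul (-1)
    have h3 := prop_denom_ne_zero ht' α w
    simp only [prop, div_eq_mul_inv]
    refine h2.congr_deriv ?_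
    field_simp
  have hv : ∀ α : ℝ, HasDerivAt (fun α : ℝ => Complex.I / t * Complex.exp (-Complex.I * α * t))
      (Complex.exp (-Complex.I * α * t)) α := by
    intro α
    have h1 : HasDerivAt (fun α : ℝ => -Complex.I * (α : ℂ) * t) (-Complex.I * 1 * t) α :=
      ((Complex.ofRealCLM.hasDerivAt (x := α)).const_mul (-Complex.I)).mul_const (t : ℂ)
    refine (h1.cexp.const_mul (Complex.I / t)).congr_deriv ?_
    field_simp
    rw [Complex.I_sq]
    ring
  have h := intervalIntegral.integral_mul_deriv_eq_deriv_mul (a := -R) (b := R)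
    (fun α _ => hu α) (fun α _ => hv α) ((hcp.pow 2).neg.intervalIntegrable _ _)
    (hce.intervalIntegrable _ _)
  simp only [oscInt, pow_one, Pi.one_apply, mul_one]
  rw [← intervalIntegral.integral_const_mul]
  calc _ = ∫ α in (-R)..R, prop α t⁻¹ w * Complex.exp (-Complex.I * α * t) := by
        simp only [mul_comm]
    _ = _ := by
        rw [h, sub_eq_add_neg, ← intervalIntegral.integral_neg]
        congr 1
        · ring
        · congr 1
          ext α
          ring

/-- Hypotheses on the size of the self-energy: `M` is a common bound, of order `log t`. -/
structure SelfEnergyBounds (δ t w : ℝ) (θ : ℂ) (M : ℝ) : Prop where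
  pos : 0 < δ
  le_one : δ ≤ 1
  le_inv : δ ≤ t⁻¹
  mem : w ∈ Set.Icc (0 : ℝ) 1
  logFactor_le : 66 * logFactor δ * (t⁻¹ * (1 / δ)) ≤ M
  norm_le : ∀ α, ‖selfEnergy α t⁻¹‖ ≤ M
  norm_boundary_le : ‖θ‖ ≤ M
  norm_sub_le : ∀ α, ‖prop α t⁻¹ w‖ * ‖selfEnergy α t⁻¹ - θ‖ ≤ M * decay α

end TwoSite

namespace TwoSite

namespace SelfEnergyBounds

variable {δ t w : ℝ} {θ : ℂ} {M : ℝ}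

theorem t_inv_pos (h : SelfEnergyBounds δ t w θ M) : 0 < t⁻¹ := h.pos.trans_le h.le_inv

theorem one_le_div (h : SelfEnergyBounds δ t w θ M) : 1 ≤ 1 / δ := by
  rw [le_div_iff₀ h.pos]; linarith [h.le_one]

theorem one_le_inv_mul_div (h : SelfEnergyBounds δ t w θ M) : 1 ≤ t⁻¹ * (1 / δ) := by
  rw [mul_one_div, le_div_iff₀ h.pos]; linarith [h.le_inv]

theorem mul_logFactor_le (h : SelfEnergyBounds δ t w θ M) : 66 * logFactor δ ≤ M := by
  refine le_trans ?_ h.logFactor_le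
  exact le_mul_of_one_le_right (by linarith [one_le_logFactor h.pos]) h.one_le_inv_mul_div

theorem one_le (h : SelfEnergyBounds δ t w θ M) : 1 ≤ M := by
  linarith [h.mul_logFactor_le, one_le_logFactor h.pos]

theorem continuous_osc (h : SelfEnergyBounds δ t w θ M) (K : ℕ) {g : ℝ → ℂ} (hg : Continuous g) :
    Continuous fun α : ℝ => Complex.exp (-Complex.I * α * t) * (prop α t⁻¹ w ^ K * g α) := by
  have := continuous_prop h.t_inv_pos continuous_id (continuous_const (y := w))
  simp only [id] at this
  fun_prop

theorem norm_osc_le (h : SelfEnergyBounds δ t w θ M) {K : ℕ} (hK : 2 ≤ K) {g : ℝ → ℂ} {G : ℝ}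
    (hG : ∀ α, ‖g α‖ ≤ G) (α : ℝ) :
    ‖Complex.exp (-Complex.I * α * t) * (prop α t⁻¹ w ^ K * g α)‖ ≤
      64 * G * (1 / δ) ^ (K - 1) * bump δ (α - w) := by
  obtain ⟨K, rfl⟩ := Nat.exists_eq_add_of_le' hK
  rw [norm_mul, norm_exp_osc, one_mul, norm_mul, norm_pow, pow_add]
  have hp := h.pos
  have h1 := norm_prop_sq_le h.pos h.le_one h.le_inv h.mem α
  have h2 := pow_le_pow_left₀ (norm_nonneg _) (norm_prop_le_inv h.pos h.le_inv α w) K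
  have h3 := (norm_nonneg _).trans (hG α)
  have hb := (bump_pos h.pos (α - w)).le
  calc _ ≤ (1 / δ) ^ K * (64 * (1 / δ) * bump δ (α - w)) * G := by
        have := hG α
        gcongr
    _ = _ := by
        rw [show K + 2 - 1 = K + 1 by omega, pow_succ]; ring

theorem tendsto_oscInt (h : SelfEnergyBounds δ t w θ M) {K : ℕ} (hK : 2 ≤ K) {g : ℝ → ℂ}
    (hg : Continuous g) {G : ℝ} (hG : ∀ α, ‖g α‖ ≤ G) :
    ∃ A, Tendsto (oscInt t w K g) atTop (𝓝 A) := by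
  refine ⟨_, tendsto_symm_interval_integral (Integrable.mono'
    (((integrable_bump h.pos).comp_sub_right w).const_mul (64 * G * (1 / δ) ^ (K - 1)))
    (h.continuous_osc K hg).aestronglyMeasurable (ae_of_all _ (h.norm_osc_le hK hG)))⟩

theorem norm_oscInt_le (h : SelfEnergyBounds δ t w θ M) {K : ℕ} (hK : 2 ≤ K) {g : ℝ → ℂ}
    {G : ℝ} (hG : ∀ α, ‖g α‖ ≤ G) {R : ℝ} (hR : 0 ≤ R) :
    ‖oscInt t w K g R‖ ≤ G * (64 * logFactor δ) * (1 / δ) ^ (K - 1) := by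
  have hG0 := (norm_nonneg _).trans (hG 0)
  have hp := h.pos
  refine (norm_interval_integral_le
    (((integrable_bump h.pos).comp_sub_right w).const_mul (64 * G * (1 / δ) ^ (K - 1)))
    (h.norm_osc_le hK hG) hR).trans ?_
  refine (integral_const_mul_bump_le (by positivity) w).trans (le_of_eq ?_)
  ring

theorem norm_oscInt_one_le (h : SelfEnergyBounds δ t w θ M) {R : ℝ} (hR : 0 ≤ R) :
    ‖oscInt t w 1 1 R‖ ≤ M := by
  have ht : 0 < t := inv_pos.1 h.t_inv_pos
  have hL := one_le_logFactor h.pos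
  have hN : 0 ≤ t⁻¹ * (1 / δ) := zero_le_one.trans h.one_le_inv_mul_div
  have h2 := h.norm_oscInt_le (K := 2) le_rfl (g := 1) (G := 1) (by simp) hR
  have h3 := norm_prop_le_inv h.pos h.le_inv R w
  have h4 := norm_prop_le_inv h.pos h.le_inv (-R) w
  have hI : ‖(Complex.I / t : ℂ)‖ = t⁻¹ := by
    rw [norm_div, Complex.norm_I, Complex.norm_real, Real.norm_of_nonneg ht.le, one_div]
  rw [oscInt_one ht]
  have h5 : ‖Complex.exp (-Complex.I * (R : ℝ) * t) * prop R t⁻¹ w -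
      Complex.exp (-Complex.I * (-R : ℝ) * t) * prop (-R) t⁻¹ w‖ ≤ 1 / δ + 1 / δ := by
    refine (_root_.norm_sub_le _ _).trans ?_
    rw [norm_mul, norm_mul, norm_exp_osc, norm_exp_osc, one_mul, one_mul]
    exact add_le_add h3 h4
  refine (norm_add_le _ _).trans ?_
  rw [norm_mul, norm_mul, hI]
  have h6 := mul_le_mul_of_nonneg_left (add_le_add h5 h2) h.t_inv_pos.le
  have h7 := h.logFactor_le
  rw [one_mul, show 2 - 1 = 1 from rfl, pow_one] at h6
  have h8 : t⁻¹ * (1 / δ) ≤ logFactor δ * (t⁻¹ * (1 / δ)) := le_mul_of_one_le_left hN hL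
  linarith

theorem tendsto_oscInt_one (h : SelfEnergyBounds δ t w θ M) :
    ∃ A, Tendsto (oscInt t w 1 1) atTop (𝓝 A) := by
  have ht : 0 < t := inv_pos.1 h.t_inv_pos
  obtain ⟨A, hA⟩ := h.tendsto_oscInt (K := 2) le_rfl (g := 1) continuous_one (G := 1) (by simp)
  have hdec : Tendsto (fun R : ℝ => 16 * (1 / δ) * decay R) atTop (𝓝 0) := by
    have h1 : Tendsto (fun R : ℝ => 1 + |R|) atTop atTop :=
      tendsto_atTop_add_const_left _ 1 tendsto_abs_atTop_atTop
    have := (tendsto_inv_atTop_zero.comp h1).const_mul (16 * (1 / δ))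
    simpa [decay, Function.comp_def] using this
  have key : ∀ s : ℝ → ℝ, (∀ R, decay (s R) = decay R) → Tendsto (fun R : ℝ =>
      Complex.exp (-Complex.I * (s R : ℝ) * t) * prop (s R) t⁻¹ w) atTop (𝓝 0) := by
    intro s hs
    refine squeeze_zero_norm (fun R => ?_) hdec
    rw [norm_mul, norm_exp_osc, one_mul, ← hs]
    exact norm_prop_le_decay h.pos h.le_one h.le_inv h.mem _
  have h1 := key id fun R => rfl
  have h2 := key (fun R => -R) fun R => by simp [decay]
  refine ⟨_, (((h1.sub h2).const_mul (Complex.I / t)).add (hA.const_mul (Complex.I / t))).congr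
    fun R => ?_⟩
  rw [oscInt_one ht]
  simp

/-- Convergence and size of the truncated one-variable integrals. -/
theorem oscInt_spec (h : SelfEnergyBounds δ t w θ M) {K a : ℕ} (hK : 1 ≤ K)
    (hKa : 1 ≤ a → 2 ≤ K) {u : ℝ → ℂ} (hu : Continuous u) (huM : ∀ α, ‖u α‖ ≤ M) :
    (∃ A, Tendsto (oscInt t w K (fun α => u α ^ a)) atTop (𝓝 A)) ∧
      ∀ R, 0 ≤ R → ‖oscInt t w K (fun α => u α ^ a) R‖ ≤ M ^ (a + 1) * (1 / δ) ^ (K - 1) := by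
  have hM := h.one_le
  have hp := h.pos
  have hua : ∀ α, ‖u α ^ a‖ ≤ M ^ a := fun α => by
    rw [norm_pow]; exact pow_le_pow_left₀ (norm_nonneg _) (huM α) a
  by_cases h2 : 2 ≤ K
  · refine ⟨h.tendsto_oscInt h2 (hu.pow a) hua, fun R hR => ?_⟩
    refine (h.norm_oscInt_le h2 hua hR).trans ?_
    rw [pow_succ]
    have := h.mul_logFactor_le
    have hL := one_le_logFactor h.pos
    gcongr
    linarith
  · obtain rfl : K = 1 := by omega
    obtain rfl : a = 0 := by by_contra ha; exact h2 (hKa (by omega))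
    have e : (fun α => u α ^ 0) = 1 := by ext; simp
    rw [e]
    refine ⟨h.tendsto_oscInt_one, fun R hR => ?_⟩
    simpa using h.norm_oscInt_one_le hR

/-- Effect on the one-variable integrals of the replacement of the self-energy. -/
theorem norm_oscInt_sub_le (h : SelfEnergyBounds δ t w θ M) {K a : ℕ}
    (hKa : 1 ≤ a → 2 ≤ K) {R : ℝ} (hR : 0 ≤ R) :
    1 / δ * ‖oscInt t w K (fun α => selfEnergy α t⁻¹ ^ a) R - oscInt t w K (fun _ => θ ^ a) R‖ ≤
      (2 * M) ^ a * M ^ 2 * (1 / δ) ^ (K - 1) := by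
  have hM := h.one_le
  have hp := h.pos
  rcases Nat.eq_zero_or_pos a with rfl | ha
  · simp only [pow_zero, sub_self, norm_zero, mul_zero]
    positivity
  obtain ⟨K, rfl⟩ := Nat.exists_eq_add_of_le' (hKa ha)
  have hc : Continuous fun α => selfEnergy α t⁻¹ ^ a := (continuous_selfEnergy h.t_inv_pos).pow a
  have hsub : oscInt t w (K + 2) (fun α => selfEnergy α t⁻¹ ^ a) R -
      oscInt t w (K + 2) (fun _ => θ ^ a) R =
      oscInt t w (K + 2) (fun α => selfEnergy α t⁻¹ ^ a - θ ^ a) R := by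
    rw [oscInt, oscInt, oscInt, ← intervalIntegral.integral_sub
      ((h.continuous_osc _ hc).intervalIntegrable _ _)
      ((h.continuous_osc _ continuous_const).intervalIntegrable _ _)]
    congr 1
    ext α
    ring
  have hb : ∀ α : ℝ, ‖Complex.exp (-Complex.I * α * t) *
      (prop α t⁻¹ w ^ (K + 2) * (selfEnergy α t⁻¹ ^ a - θ ^ a))‖ ≤
      4 * ((2 * M) ^ a * M * (1 / δ) ^ K) * bump δ (α - w) := by
    intro α
    rw [norm_mul, norm_exp_osc, one_mul, norm_mul, norm_pow]
    have h1 := norm_pow_sub_pow_le hM (h.norm_le α) h.norm_boundary_le a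
    have h2 := pow_le_pow_left₀ (norm_nonneg _) (norm_prop_le_inv h.pos h.le_inv α w) K
    have h3 := h.norm_sub_le α
    have h4 := norm_prop_mul_decay_le h.pos h.le_inv h.mem α
    have hd := (decay_pos α).le
    calc _ ≤ ‖prop α t⁻¹ w‖ ^ (K + 2) * ((2 * M) ^ a * ‖selfEnergy α t⁻¹ - θ‖) := by gcongr
      _ = (2 * M) ^ a * ‖prop α t⁻¹ w‖ ^ K * (‖prop α t⁻¹ w‖ *
          (‖prop α t⁻¹ w‖ * ‖selfEnergy α t⁻¹ - θ‖)) := by ring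
      _ ≤ (2 * M) ^ a * (1 / δ) ^ K * (‖prop α t⁻¹ w‖ * (M * decay α)) := by gcongr
      _ = (2 * M) ^ a * (1 / δ) ^ K * M * (‖prop α t⁻¹ w‖ * decay α) := by ring
      _ ≤ (2 * M) ^ a * (1 / δ) ^ K * M * (4 * bump δ (α - w)) := by gcongr
      _ = _ := by ring
  rw [hsub, show K + 2 - 1 = K + 1 by omega, pow_succ]
  have h5 : ‖oscInt t w (K + 2) (fun α => selfEnergy α t⁻¹ ^ a - θ ^ a) R‖ ≤
      4 * ((2 * M) ^ a * M * (1 / δ) ^ K) * logFactor δ :=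
    (norm_interval_integral_le (((integrable_bump h.pos).comp_sub_right w).const_mul _) hb
      hR).trans (integral_const_mul_bump_le (by positivity) w)
  have h6 : 4 * logFactor δ ≤ M := by linarith [h.mul_logFactor_le, one_le_logFactor h.pos]
  calc _ ≤ 1 / δ * (4 * ((2 * M) ^ a * M * (1 / δ) ^ K) * logFactor δ) := by gcongr
    _ = (2 * M) ^ a * M * (4 * logFactor δ) * ((1 / δ) ^ K * (1 / δ)) := by ring
    _ ≤ (2 * M) ^ a * M * M * ((1 / δ) ^ K * (1 / δ)) := by gcongr
    _ = _ := by ring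

end SelfEnergyBounds

end TwoSite

namespace TwoSite

/-- The oscillating factor of the `α`-representation. -/
noncomputable def phase (t α β : ℝ) : ℂ :=
  Complex.exp (-Complex.I * (α - β) * t) * Complex.exp (2 * (t⁻¹ : ℝ) * t)

theorem phase_eq (t α β : ℝ) : phase t α β = Complex.exp (2 * (t⁻¹ : ℝ) * t) *
    (Complex.exp (-Complex.I * α * t) *
      (starRingEnd ℂ) (Complex.exp (-Complex.I * β * t))) := by
  have h : (starRingEnd ℂ) (Complex.exp (-Complex.I * β * t)) =
      Complex.exp (Complex.I * β * t) := by
    rw [← Complex.exp_conj]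
    simp
  rw [phase, h, mul_comm, ← Complex.exp_add (-Complex.I * α * t)]
  congr 2
  ring

theorem norm_exp_two {t : ℝ} (ht : 0 < t) : ‖Complex.exp (2 * (t⁻¹ : ℝ) * t)‖ = Real.exp 2 := by
  rw [Complex.norm_exp]
  congr 1
  have : (2 * ((t⁻¹ : ℝ) : ℂ) * t) = ((2 * t⁻¹ * t : ℝ) : ℂ) := by push_cast; ring
  rw [this, Complex.ofReal_re]
  field_simp

theorem norm_phase {t : ℝ} (ht : 0 < t) (α β : ℝ) : ‖phase t α β‖ = Real.exp 2 := by
  rw [phase_eq, norm_mul, norm_mul, RCLike.norm_conj, norm_exp_osc, norm_exp_osc,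
    norm_exp_two ht, one_mul, mul_one]

theorem continuous_phase (t : ℝ) : Continuous fun p : ℝ × ℝ => phase t p.1 p.2 := by
  unfold phase; fun_prop

variable {ι : Type*}

/-- The product of the integrals of the variables which carry propagators of both kinds. -/
noncomputable def rungProd (η : ℝ) (s : Finset ι) (kk pp : ι → ℕ) (α β : ℝ) : ℂ :=
  ∏ j ∈ s, classIntegral α β η (kk j) (pp j)

/-- The integrand of the `α`-representation at a fixed initial energy `w`, with a function `u`
in place of the self-energy. -/
noncomputable def planeIntegrand (t w : ℝ) (K P a b : ℕ) (s : Finset ι) (kk pp : ι → ℕ)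
    (u : ℝ → ℂ) (α β : ℝ) : ℂ :=
  phase t α β * (prop α t⁻¹ w ^ K * propBar β t⁻¹ w ^ P *
    (u α ^ a * (starRingEnd ℂ) (u β) ^ b * rungProd t⁻¹ s kk pp α β))

/-- The integral of `planeIntegrand` over `[-R,R]²`. -/
noncomputable def squareInt (t w : ℝ) (K P a b : ℕ) (s : Finset ι) (kk pp : ι → ℕ)
    (u : ℝ → ℂ) (R : ℝ) : ℂ :=
  ∫ α in (-R)..R, ∫ β in (-R)..R, planeIntegrand t w K P a b s kk pp u α β

/-- The number of factors `t` in the estimate of `squareInt`. -/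
def powerCount (K P : ℕ) (s : Finset ι) (kk pp : ι → ℕ) : ℕ :=
  K - 1 + (P - 1) + ∑ j ∈ s, (kk j - 1 + (pp j - 1)) + s.card

namespace SelfEnergyBounds

variable {δ t w : ℝ} {θ : ℂ} {M : ℝ} {K P a b : ℕ} {s : Finset ι} {kk pp : ι → ℕ}

theorem norm_rungProd_le (h : SelfEnergyBounds δ t w θ M) (hs : s.Nonempty)
    (hkp : ∀ j ∈ s, 1 ≤ kk j ∧ 1 ≤ pp j) (α β : ℝ) :
    ‖rungProd t⁻¹ s kk pp α β‖ ≤ (1 / δ) ^ (∑ j ∈ s, (kk j - 1 + (pp j - 1))) *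
      (M * (1 / δ)) ^ (s.card - 1) * rung t⁻¹ α β := by
  have hr : rung t⁻¹ α β ≤ M * (1 / δ) := by
    refine (rung_le_div h.pos h.le_inv α β).trans ?_
    have := h.mul_logFactor_le
    have hL := one_le_logFactor h.pos
    exact mul_le_mul_of_nonneg_right (by linarith) (zero_le_one.trans h.one_le_div)
  have h0 := rung_nonneg t⁻¹ α β
  have hp := h.pos
  have hpos : 0 < s.card := hs.card_pos
  calc ‖rungProd t⁻¹ s kk pp α β‖
      ≤ ∏ j ∈ s, (1 / δ) ^ (kk j - 1 + (pp j - 1)) * rung t⁻¹ α β := by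
        rw [rungProd, norm_prod]
        exact Finset.prod_le_prod (fun _ _ => norm_nonneg _) fun j hj =>
          norm_classIntegral_le h.pos h.le_inv α β (hkp j hj).1 (hkp j hj).2
    _ = (1 / δ) ^ (∑ j ∈ s, (kk j - 1 + (pp j - 1))) *
        (rung t⁻¹ α β ^ (s.card - 1) * rung t⁻¹ α β) := by
        rw [Finset.prod_mul_distrib, Finset.prod_pow_eq_pow_sum, Finset.prod_const, ← pow_succ,
          Nat.sub_add_cancel hpos]
    _ ≤ _ := by
        rw [← mul_assoc]
        gcongr

theorem continuous_planeIntegrand (h : SelfEnergyBounds δ t w θ M) {u : ℝ → ℂ}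
    (hu : Continuous u) :
    Continuous fun p : ℝ × ℝ => planeIntegrand t w K P a b s kk pp u p.1 p.2 := by
  have h1 := continuous_phase t
  have h2 : Continuous fun p : ℝ × ℝ => prop p.1 t⁻¹ w :=
    continuous_prop h.t_inv_pos continuous_fst continuous_const
  have h3 : Continuous fun p : ℝ × ℝ => propBar p.2 t⁻¹ w :=
    continuous_propBar h.t_inv_pos continuous_snd continuous_const
  have h4 : Continuous fun p : ℝ × ℝ => u p.1 := hu.comp continuous_fst
  have h5 : Continuous fun p : ℝ × ℝ => (starRingEnd ℂ) (u p.2) :=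
    Complex.continuous_conj.comp (hu.comp continuous_snd)
  have h6 : Continuous fun p : ℝ × ℝ => rungProd t⁻¹ s kk pp p.1 p.2 :=
    continuous_finsetProd _ fun j _ => continuous_classIntegral h.t_inv_pos _ _
  exact h1.mul (((h2.pow K).mul (h3.pow P)).mul (((h4.pow a).mul (h5.pow b)).mul h6))

/-- Removing all but one of the propagators which carry the initial energy. -/
theorem norm_prop_pow_mul_le (h : SelfEnergyBounds δ t w θ M) (hK : 1 ≤ K) (hP : 1 ≤ P)
    (hs : s.Nonempty) (hkp : ∀ j ∈ s, 1 ≤ kk j ∧ 1 ≤ pp j) (α β : ℝ) :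
    ‖phase t α β * (prop α t⁻¹ w ^ K * propBar β t⁻¹ w ^ P)‖ * ‖rungProd t⁻¹ s kk pp α β‖ ≤
      Real.exp 2 * M ^ (s.card - 1) * (1 / δ) ^ (powerCount K P s kk pp - 1) *
        (‖prop α t⁻¹ w‖ * ‖prop β t⁻¹ w‖ * rung t⁻¹ α β) := by
  have hp := h.pos
  have hM := h.one_le
  have ht : 0 < t := inv_pos.1 h.t_inv_pos
  have hcard := hs.card_pos
  have h1 := h.norm_rungProd_le hs hkp α β
  have h2 := pow_le_pow_left₀ (norm_nonneg _) (norm_prop_le_inv h.pos h.le_inv α w) (K - 1)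
  have h3 := pow_le_pow_left₀ (norm_nonneg _) (norm_prop_le_inv h.pos h.le_inv β w) (P - 1)
  have hr := rung_nonneg t⁻¹ α β
  have eK : ‖prop α t⁻¹ w‖ ^ K = ‖prop α t⁻¹ w‖ ^ (K - 1) * ‖prop α t⁻¹ w‖ := by
    rw [← pow_succ, Nat.sub_add_cancel hK]
  have eP : ‖prop β t⁻¹ w‖ ^ P = ‖prop β t⁻¹ w‖ ^ (P - 1) * ‖prop β t⁻¹ w‖ := by
    rw [← pow_succ, Nat.sub_add_cancel hP]
  have e3 : powerCount K P s kk pp - 1 =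
      (K - 1) + (P - 1) + (∑ j ∈ s, (kk j - 1 + (pp j - 1))) + (s.card - 1) := by
    unfold powerCount; omega
  rw [norm_mul, norm_phase ht, norm_mul, norm_pow, norm_pow, norm_propBar, eK, eP, e3, pow_add,
    pow_add, pow_add]
  rw [mul_pow] at h1
  calc _ ≤ Real.exp 2 * ((1 / δ) ^ (K - 1) * ‖prop α t⁻¹ w‖ *
        ((1 / δ) ^ (P - 1) * ‖prop β t⁻¹ w‖)) *
        ((1 / δ) ^ (∑ j ∈ s, (kk j - 1 + (pp j - 1))) *
          (M ^ (s.card - 1) * (1 / δ) ^ (s.card - 1)) * rung t⁻¹ α β) := by gcongr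
    _ = _ := by ring

theorem norm_planeIntegrand_le (h : SelfEnergyBounds δ t w θ M) (hK : 1 ≤ K) (hP : 1 ≤ P)
    (hs : s.Nonempty) (hkp : ∀ j ∈ s, 1 ≤ kk j ∧ 1 ≤ pp j) {u : ℝ → ℂ} (hu : ∀ α, ‖u α‖ ≤ M)
    (α β : ℝ) :
    ‖planeIntegrand t w K P a b s kk pp u α β‖ ≤
      Real.exp 2 * M ^ (a + b + s.card) * (1 / δ) ^ powerCount K P s kk pp *
        (16 * majorant δ w α β) := by
  have hp := h.pos
  have hM := h.one_le
  have hcard := hs.card_pos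
  have h1 := h.norm_prop_pow_mul_le hK hP hs hkp α β
  have h2 := pow_le_pow_left₀ (norm_nonneg _) (hu α) a
  have h3 := pow_le_pow_left₀ (norm_nonneg _) (hu β) b
  have h4 := norm_prop_le_decay h.pos h.le_one h.le_inv h.mem α
  have h5 := decay_mul_norm_prop_mul_rung_le h.pos h.le_one h.le_inv h.mem α β
  have h6 : 64 * logFactor δ ≤ M := by linarith [h.mul_logFactor_le, one_le_logFactor h.pos]
  have hm := majorant_nonneg h.pos w α β
  have hr := rung_nonneg t⁻¹ α β
  have h7 : ‖prop α t⁻¹ w‖ * ‖prop β t⁻¹ w‖ * rung t⁻¹ α β ≤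
      (1 / δ) * M * (16 * majorant δ w α β) := by
    calc _ ≤ 16 * (1 / δ) * decay α * ‖prop β t⁻¹ w‖ * rung t⁻¹ α β := by gcongr
      _ = 16 * (1 / δ) * (decay α * ‖prop β t⁻¹ w‖ * rung t⁻¹ α β) := by ring
      _ ≤ 16 * (1 / δ) * (64 * logFactor δ * majorant δ w α β) := by gcongr
      _ ≤ 16 * (1 / δ) * (M * majorant δ w α β) := by gcongr
      _ = _ := by ring
  have hpc : 1 ≤ powerCount K P s kk pp := by unfold powerCount; omega
  have e1 : (1 / δ) ^ powerCount K P s kk pp =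
      (1 / δ) ^ (powerCount K P s kk pp - 1) * (1 / δ) := by
    rw [← pow_succ, Nat.sub_add_cancel hpc]
  have e2 : M ^ s.card = M ^ (s.card - 1) * M := by rw [← pow_succ, Nat.sub_add_cancel hcard]
  calc ‖planeIntegrand t w K P a b s kk pp u α β‖
      = ‖phase t α β * (prop α t⁻¹ w ^ K * propBar β t⁻¹ w ^ P)‖ *
        ‖rungProd t⁻¹ s kk pp α β‖ * (‖u α‖ ^ a * ‖u β‖ ^ b) := by
        simp only [planeIntegrand, norm_mul, norm_pow, RCLike.norm_conj]; ring
    _ ≤ Real.exp 2 * M ^ (s.card - 1) * (1 / δ) ^ (powerCount K P s kk pp - 1) *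
        ((1 / δ) * M * (16 * majorant δ w α β)) * (M ^ a * M ^ b) := by
        have h8 := h1.trans (mul_le_mul_of_nonneg_left h7 (by positivity))
        have h9 := mul_le_mul h2 h3 (by positivity) (by positivity)
        exact mul_le_mul h8 h9 (by positivity) ((by positivity : (0 : ℝ) ≤ _).trans h8)
    _ = _ := by rw [pow_add, pow_add, e1, e2]; ring

theorem integrable_planeIntegrand (h : SelfEnergyBounds δ t w θ M) (hK : 1 ≤ K) (hP : 1 ≤ P)
    (hs : s.Nonempty) (hkp : ∀ j ∈ s, 1 ≤ kk j ∧ 1 ≤ pp j) {u : ℝ → ℂ} (huc : Continuous u)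
    (hu : ∀ α, ‖u α‖ ≤ M) :
    Integrable fun p : ℝ × ℝ => planeIntegrand t w K P a b s kk pp u p.1 p.2 :=
  Integrable.mono' (((integrable_majorant h.pos w).const_mul 16).const_mul _)
    (h.continuous_planeIntegrand huc).aestronglyMeasurable
    (ae_of_all _ fun p => h.norm_planeIntegrand_le hK hP hs hkp hu p.1 p.2)

theorem norm_squareInt_le_of_nonempty (h : SelfEnergyBounds δ t w θ M) (hK : 1 ≤ K) (hP : 1 ≤ P)
    (hs : s.Nonempty) (hkp : ∀ j ∈ s, 1 ≤ kk j ∧ 1 ≤ pp j) {u : ℝ → ℂ} (huc : Continuous u)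
    (hu : ∀ α, ‖u α‖ ≤ M) {R : ℝ} (hR : 0 ≤ R) :
    ‖squareInt t w K P a b s kk pp u R‖ ≤
      Real.exp 2 * M ^ (a + b + s.card + 2) * (1 / δ) ^ powerCount K P s kk pp := by
  have hp := h.pos
  have hM := h.one_le
  have hL := one_le_logFactor h.pos
  have hi := h.integrable_planeIntegrand (a := a) (b := b) hK hP hs hkp huc hu
  have h1 : 16 * ∫ p : ℝ × ℝ, majorant δ w p.1 p.2 ≤ M ^ 2 := by
    have h2 := integral_majorant_le h.pos w
    have h3 := pow_le_pow_left₀ (by positivity) h.mul_logFactor_le 2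
    nlinarith
  refine (norm_square_integral_le hi hR).trans ((integral_mono hi.norm
    (((integrable_majorant h.pos w).const_mul 16).const_mul _)
    fun p => h.norm_planeIntegrand_le hK hP hs hkp hu p.1 p.2).trans ?_)
  rw [integral_const_mul, integral_const_mul]
  calc _ ≤ Real.exp 2 * M ^ (a + b + s.card) * (1 / δ) ^ powerCount K P s kk pp * M ^ 2 := by
        gcongr
    _ = _ := by rw [pow_add M (a + b + s.card)]; ring

theorem norm_pow_mul_conj_pow_sub_le (h : SelfEnergyBounds δ t w θ M) (α β : ℝ) :
    ‖selfEnergy α t⁻¹ ^ a * (starRingEnd ℂ) (selfEnergy β t⁻¹) ^ b -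
        θ ^ a * (starRingEnd ℂ) θ ^ b‖ ≤
      (2 * M) ^ (a + b) * (‖selfEnergy α t⁻¹ - θ‖ + ‖selfEnergy β t⁻¹ - θ‖) := by
  have hM := h.one_le
  have e : selfEnergy α t⁻¹ ^ a * (starRingEnd ℂ) (selfEnergy β t⁻¹) ^ b -
      θ ^ a * (starRingEnd ℂ) θ ^ b = (selfEnergy α t⁻¹ ^ a - θ ^ a) *
        (starRingEnd ℂ) (selfEnergy β t⁻¹) ^ b +
      θ ^ a * (starRingEnd ℂ) (selfEnergy β t⁻¹ ^ b - θ ^ b) := by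
    simp only [map_sub, map_pow]; ring
  have h1 := norm_pow_sub_pow_le hM (h.norm_le α) h.norm_boundary_le a
  have h2 := norm_pow_sub_pow_le hM (h.norm_le β) h.norm_boundary_le b
  have h3 := pow_le_pow_left₀ (norm_nonneg _)
    ((h.norm_le β).trans (by linarith : M ≤ 2 * M)) b
  have h4 := pow_le_pow_left₀ (norm_nonneg _)
    (h.norm_boundary_le.trans (by linarith : M ≤ 2 * M)) a
  rw [e]
  refine (norm_add_le _ _).trans ?_
  rw [norm_mul, norm_mul, norm_pow, norm_pow, RCLike.norm_conj, RCLike.norm_conj]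
  calc _ ≤ (2 * M) ^ a * ‖selfEnergy α t⁻¹ - θ‖ * (2 * M) ^ b +
        (2 * M) ^ a * ((2 * M) ^ b * ‖selfEnergy β t⁻¹ - θ‖) := by gcongr
    _ = _ := by rw [pow_add]; ring

theorem norm_planeIntegrand_sub_le (h : SelfEnergyBounds δ t w θ M) (hK : 1 ≤ K) (hP : 1 ≤ P)
    (hs : s.Nonempty) (hkp : ∀ j ∈ s, 1 ≤ kk j ∧ 1 ≤ pp j) (α β : ℝ) :
    ‖planeIntegrand t w K P a b s kk pp (fun α => selfEnergy α t⁻¹) α β -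
        planeIntegrand t w K P a b s kk pp (fun _ => θ) α β‖ ≤
      Real.exp 2 * (2 * M) ^ (a + b + s.card) * (1 / δ) ^ (powerCount K P s kk pp - 1) *
        (M * (majorant δ w α β + majorant δ w β α)) := by
  have hp := h.pos
  have hM := h.one_le
  have hcard := hs.card_pos
  have hr := rung_nonneg t⁻¹ α β
  have h1 := h.norm_prop_pow_mul_le hK hP hs hkp α β
  have h2 := h.norm_pow_mul_conj_pow_sub_le (a := a) (b := b) α β
  have h3 := decay_mul_norm_prop_mul_rung_le h.pos h.le_one h.le_inv h.mem α β
  have h4 := decay_mul_norm_prop_mul_rung_le h.pos h.le_one h.le_inv h.mem β α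
  have h5 : 64 * logFactor δ ≤ M := by linarith [h.mul_logFactor_le, one_le_logFactor h.pos]
  have hm1 := majorant_nonneg h.pos w α β
  have hm2 := majorant_nonneg h.pos w β α
  rw [rung_comm] at h4
  have h6 : ‖prop α t⁻¹ w‖ * ‖prop β t⁻¹ w‖ * rung t⁻¹ α β *
      (‖selfEnergy α t⁻¹ - θ‖ + ‖selfEnergy β t⁻¹ - θ‖) ≤
      M * (M * (majorant δ w α β + majorant δ w β α)) := by
    calc _ = ‖prop α t⁻¹ w‖ * ‖selfEnergy α t⁻¹ - θ‖ * (‖prop β t⁻¹ w‖ * rung t⁻¹ α β) +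
          ‖prop β t⁻¹ w‖ * ‖selfEnergy β t⁻¹ - θ‖ * (‖prop α t⁻¹ w‖ * rung t⁻¹ α β) := by ring
      _ ≤ M * decay α * (‖prop β t⁻¹ w‖ * rung t⁻¹ α β) +
          M * decay β * (‖prop α t⁻¹ w‖ * rung t⁻¹ α β) := by
          have := h.norm_sub_le α
          have := h.norm_sub_le β
          gcongr
      _ = M * (decay α * ‖prop β t⁻¹ w‖ * rung t⁻¹ α β +
          decay β * ‖prop α t⁻¹ w‖ * rung t⁻¹ α β) := by ring
      _ ≤ M * (64 * logFactor δ * majorant δ w α β + 64 * logFactor δ * majorant δ w β α) := by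
          gcongr
      _ ≤ M * (M * majorant δ w α β + M * majorant δ w β α) := by gcongr
      _ = _ := by ring
  have e2 : M ^ (s.card - 1) * M = M ^ s.card := by rw [← pow_succ, Nat.sub_add_cancel hcard]
  have h7 : M ^ s.card ≤ (2 * M) ^ s.card := by gcongr; linarith
  calc _ = ‖phase t α β * (prop α t⁻¹ w ^ K * propBar β t⁻¹ w ^ P)‖ *
        ‖rungProd t⁻¹ s kk pp α β‖ * ‖selfEnergy α t⁻¹ ^ a *
          (starRingEnd ℂ) (selfEnergy β t⁻¹) ^ b - θ ^ a * (starRingEnd ℂ) θ ^ b‖ := by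
        rw [← norm_mul, ← norm_mul, planeIntegrand, planeIntegrand]
        congr 1
        ring
    _ ≤ Real.exp 2 * M ^ (s.card - 1) * (1 / δ) ^ (powerCount K P s kk pp - 1) *
        (‖prop α t⁻¹ w‖ * ‖prop β t⁻¹ w‖ * rung t⁻¹ α β) *
        ((2 * M) ^ (a + b) * (‖selfEnergy α t⁻¹ - θ‖ + ‖selfEnergy β t⁻¹ - θ‖)) := by gcongr
    _ = Real.exp 2 * M ^ (s.card - 1) * (1 / δ) ^ (powerCount K P s kk pp - 1) *
        (2 * M) ^ (a + b) * (‖prop α t⁻¹ w‖ * ‖prop β t⁻¹ w‖ * rung t⁻¹ α β *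
          (‖selfEnergy α t⁻¹ - θ‖ + ‖selfEnergy β t⁻¹ - θ‖)) := by ring
    _ ≤ Real.exp 2 * M ^ (s.card - 1) * (1 / δ) ^ (powerCount K P s kk pp - 1) *
        (2 * M) ^ (a + b) * (M * (M * (majorant δ w α β + majorant δ w β α))) := by gcongr
    _ = Real.exp 2 * ((2 * M) ^ (a + b) * (M ^ (s.card - 1) * M)) *
        (1 / δ) ^ (powerCount K P s kk pp - 1) *
        (M * (majorant δ w α β + majorant δ w β α)) := by ring
    _ ≤ Real.exp 2 * ((2 * M) ^ (a + b) * (2 * M) ^ s.card) *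
        (1 / δ) ^ (powerCount K P s kk pp - 1) *
        (M * (majorant δ w α β + majorant δ w β α)) := by rw [e2]; gcongr
    _ = _ := by rw [← pow_add]

theorem norm_squareInt_sub_le_of_nonempty (h : SelfEnergyBounds δ t w θ M) (hK : 1 ≤ K)
    (hP : 1 ≤ P) (hs : s.Nonempty) (hkp : ∀ j ∈ s, 1 ≤ kk j ∧ 1 ≤ pp j) {R : ℝ} (hR : 0 ≤ R) :
    1 / δ * ‖squareInt t w K P a b s kk pp (fun α => selfEnergy α t⁻¹) R -
        squareInt t w K P a b s kk pp (fun _ => θ) R‖ ≤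
      2 * Real.exp 2 * (2 * M) ^ (a + b + s.card + 3) * (1 / δ) ^ powerCount K P s kk pp := by
  have hp := h.pos
  have hM := h.one_le
  have hL := one_le_logFactor h.pos
  have hcard := hs.card_pos
  have hi1 := h.integrable_planeIntegrand (a := a) (b := b) hK hP hs hkp
    (continuous_selfEnergy h.t_inv_pos) h.norm_le
  have hi2 := h.integrable_planeIntegrand (a := a) (b := b) hK hP hs hkp
    (u := fun _ => θ) continuous_const (fun _ => h.norm_boundary_le)
  have hm := integrable_majorant h.pos w
  have hm' : Integrable (fun p : ℝ × ℝ => majorant δ w p.2 p.1) := hm.swap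
  have hI' : ∫ p : ℝ × ℝ, majorant δ w p.2 p.1 = ∫ p : ℝ × ℝ, majorant δ w p.1 p.2 :=
    integral_prod_swap (μ := volume) (ν := volume) (fun p : ℝ × ℝ => majorant δ w p.1 p.2)
  have h1 : ∫ p : ℝ × ℝ, (majorant δ w p.1 p.2 + majorant δ w p.2 p.1) ≤ M ^ 2 := by
    have h2 := integral_majorant_le h.pos w
    have h3 := pow_le_pow_left₀ (by positivity) h.mul_logFactor_le 2
    rw [integral_add hm hm', hI']
    nlinarith
  have h2 : ‖squareInt t w K P a b s kk pp (fun α => selfEnergy α t⁻¹) R -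
      squareInt t w K P a b s kk pp (fun _ => θ) R‖ ≤
      Real.exp 2 * (2 * M) ^ (a + b + s.card) * (1 / δ) ^ (powerCount K P s kk pp - 1) *
        (M * M ^ 2) := by
    have e : squareInt t w K P a b s kk pp (fun α => selfEnergy α t⁻¹) R -
        squareInt t w K P a b s kk pp (fun _ => θ) R =
        ∫ α in (-R)..R, ∫ β in (-R)..R,
          (planeIntegrand t w K P a b s kk pp (fun α => selfEnergy α t⁻¹) α β -
            planeIntegrand t w K P a b s kk pp (fun _ => θ) α β) := by
      have e1 := square_integral_eq hi1 hR
      have e2 := square_integral_eq hi2 hR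
      have e3 := square_integral_eq (hi1.sub hi2) hR
      simp only [Pi.sub_apply] at e3
      rw [squareInt, squareInt, e1, e2, e3,
        integral_sub hi1.integrableOn hi2.integrableOn]
    rw [e]
    have h3 := norm_square_integral_le (hi1.sub hi2) hR
    simp only [Pi.sub_apply] at h3
    refine h3.trans ((integral_mono (hi1.sub hi2).norm (((hm.add hm').const_mul M).const_mul _)
      fun p => h.norm_planeIntegrand_sub_le hK hP hs hkp p.1 p.2).trans ?_)
    simp only [Pi.add_apply]
    rw [integral_const_mul, integral_const_mul]
    gcongr
  have hpc : 1 ≤ powerCount K P s kk pp := by unfold powerCount; omega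
  have e1 : (1 / δ) ^ powerCount K P s kk pp =
      (1 / δ) ^ (powerCount K P s kk pp - 1) * (1 / δ) := by
    rw [← pow_succ, Nat.sub_add_cancel hpc]
  calc _ ≤ 1 / δ * (Real.exp 2 * (2 * M) ^ (a + b + s.card) *
        (1 / δ) ^ (powerCount K P s kk pp - 1) * (M * M ^ 2)) := by gcongr
    _ = Real.exp 2 * (2 * M) ^ (a + b + s.card) * M ^ 3 *
        ((1 / δ) ^ (powerCount K P s kk pp - 1) * (1 / δ)) := by ring
    _ ≤ (2 * Real.exp 2) * (2 * M) ^ (a + b + s.card) * (2 * M) ^ 3 *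
        ((1 / δ) ^ (powerCount K P s kk pp - 1) * (1 / δ)) := by
        have := Real.exp_pos 2
        gcongr
        · linarith
        · linarith
    _ = _ := by rw [e1, pow_add (2 * M) (a + b + s.card)]; ring

/-- Without rungs the plane integral is a product of one-variable integrals. -/
theorem squareInt_empty (t w : ℝ) (K P a b : ℕ) (kk pp : ι → ℕ) (u : ℝ → ℂ) (R : ℝ) :
    squareInt t w K P a b ∅ kk pp u R = Complex.exp (2 * (t⁻¹ : ℝ) * t) *
      (oscInt t w K (fun α => u α ^ a) R *
        (starRingEnd ℂ) (oscInt t w P (fun α => u α ^ b) R)) := by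
  have e1 : ∀ α β, planeIntegrand t w K P a b (∅ : Finset ι) kk pp u α β =
      Complex.exp (2 * (t⁻¹ : ℝ) * t) *
        (Complex.exp (-Complex.I * α * t) * (prop α t⁻¹ w ^ K * u α ^ a)) *
        (starRingEnd ℂ) (Complex.exp (-Complex.I * β * t) * (prop β t⁻¹ w ^ P * u β ^ b)) := by
    intro α β
    rw [planeIntegrand, phase_eq]
    simp only [rungProd, Finset.prod_empty, map_mul, map_pow, conj_prop]
    ring
  have e2 : (starRingEnd ℂ) (oscInt t w P (fun α => u α ^ b) R) = ∫ β in (-R)..R,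
      (starRingEnd ℂ) (Complex.exp (-Complex.I * β * t) * (prop β t⁻¹ w ^ P * u β ^ b)) := by
    simp only [oscInt, intervalIntegral, map_sub, integral_conj]
  rw [e2, squareInt]
  simp only [e1, intervalIntegral.integral_const_mul, intervalIntegral.integral_mul_const]
  rw [oscInt]
  ring

theorem norm_squareInt_sub_le_of_empty (h : SelfEnergyBounds δ t w θ M) (hK : 1 ≤ K)
    (hP : 1 ≤ P) (ha : 1 ≤ a → 2 ≤ K) (hb : 1 ≤ b → 2 ≤ P) {R : ℝ} (hR : 0 ≤ R) :
    1 / δ * ‖squareInt t w K P a b ∅ kk pp (fun α => selfEnergy α t⁻¹) R -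
        squareInt t w K P a b ∅ kk pp (fun _ => θ) R‖ ≤
      2 * Real.exp 2 * (2 * M) ^ (a + b + 3) * (1 / δ) ^ (K - 1 + (P - 1)) := by
  have hp := h.pos
  have hM := h.one_le
  have ht : 0 < t := inv_pos.1 h.t_inv_pos
  have hA := (h.oscInt_spec hK ha (u := fun _ => θ) continuous_const
    fun _ => h.norm_boundary_le).2 R hR
  have hB := (h.oscInt_spec hP hb (continuous_selfEnergy h.t_inv_pos) h.norm_le).2 R hR
  have hdA := h.norm_oscInt_sub_le ha hR
  have hdB := h.norm_oscInt_sub_le hb hR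
  rw [squareInt_empty, squareInt_empty]
  set A := oscInt t w K (fun α => selfEnergy α t⁻¹ ^ a) R
  set A' := oscInt t w K (fun _ => θ ^ a) R
  set B := oscInt t w P (fun α => selfEnergy α t⁻¹ ^ b) R
  set B' := oscInt t w P (fun _ => θ ^ b) R
  have e : Complex.exp (2 * (t⁻¹ : ℝ) * t) * (A * (starRingEnd ℂ) B) -
      Complex.exp (2 * (t⁻¹ : ℝ) * t) * (A' * (starRingEnd ℂ) B') =
      Complex.exp (2 * (t⁻¹ : ℝ) * t) * ((A - A') * (starRingEnd ℂ) B +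
        A' * (starRingEnd ℂ) (B - B')) := by
    rw [map_sub]; ring
  rw [e, norm_mul, norm_exp_two ht]
  have h1 : 1 / δ * ‖(A - A') * (starRingEnd ℂ) B + A' * (starRingEnd ℂ) (B - B')‖ ≤
      (1 / δ * ‖A - A'‖) * ‖B‖ + ‖A'‖ * (1 / δ * ‖B - B'‖) := by
    have := norm_add_le ((A - A') * (starRingEnd ℂ) B) (A' * (starRingEnd ℂ) (B - B'))
    rw [norm_mul, norm_mul, RCLike.norm_conj, RCLike.norm_conj] at this
    have := mul_le_mul_of_nonneg_left this (zero_le_one.trans h.one_le_div)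
    linarith
  have hMa : ∀ c, M ^ c ≤ (2 * M) ^ c := fun c => by gcongr; linarith
  calc _ = Real.exp 2 * (1 / δ * ‖(A - A') * (starRingEnd ℂ) B +
        A' * (starRingEnd ℂ) (B - B')‖) := by ring
    _ ≤ Real.exp 2 * ((1 / δ * ‖A - A'‖) * ‖B‖ + ‖A'‖ * (1 / δ * ‖B - B'‖)) := by gcongr
    _ ≤ Real.exp 2 * (((2 * M) ^ a * M ^ 2 * (1 / δ) ^ (K - 1)) *
        (M ^ (b + 1) * (1 / δ) ^ (P - 1)) + (M ^ (a + 1) * (1 / δ) ^ (K - 1)) *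
        ((2 * M) ^ b * M ^ 2 * (1 / δ) ^ (P - 1))) := by gcongr
    _ ≤ Real.exp 2 * (((2 * M) ^ a * (2 * M) ^ 2 * (1 / δ) ^ (K - 1)) *
        ((2 * M) ^ (b + 1) * (1 / δ) ^ (P - 1)) + ((2 * M) ^ (a + 1) * (1 / δ) ^ (K - 1)) *
        ((2 * M) ^ b * (2 * M) ^ 2 * (1 / δ) ^ (P - 1))) := by
        have := hMa 2
        have := hMa (b + 1)
        have := hMa (a + 1)
        gcongr
    _ = _ := by rw [pow_add (1 / δ)]; ring

/-- Convergence and size of the plane integrals at fixed initial energy. -/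
theorem squareInt_spec (h : SelfEnergyBounds δ t w θ M) (hK : 1 ≤ K) (hP : 1 ≤ P)
    (hkp : ∀ j ∈ s, 1 ≤ kk j ∧ 1 ≤ pp j) (ha : s = ∅ → 1 ≤ a → 2 ≤ K)
    (hb : s = ∅ → 1 ≤ b → 2 ≤ P) {u : ℝ → ℂ} (huc : Continuous u) (hu : ∀ α, ‖u α‖ ≤ M) :
    (∃ S, Tendsto (squareInt t w K P a b s kk pp u) atTop (𝓝 S)) ∧
      ∀ R, 0 ≤ R → ‖squareInt t w K P a b s kk pp u R‖ ≤
        Real.exp 2 * M ^ (a + b + s.card + 2) * (1 / δ) ^ powerCount K P s kk pp := by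
  rcases s.eq_empty_or_nonempty with rfl | hs
  · obtain ⟨⟨A, hA⟩, hA'⟩ := h.oscInt_spec hK (ha rfl) huc hu
    obtain ⟨⟨B, hB⟩, hB'⟩ := h.oscInt_spec hP (hb rfl) huc hu
    constructor
    · refine ⟨Complex.exp (2 * (t⁻¹ : ℝ) * t) * (A * (starRingEnd ℂ) B), ?_⟩
      have := (hA.mul ((Complex.continuous_conj.tendsto B).comp hB)).const_mul
        (Complex.exp (2 * (t⁻¹ : ℝ) * t))
      exact this.congr fun R => (squareInt_empty t w K P a b kk pp u R).symm
    · intro R hR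
      have ht : 0 < t := inv_pos.1 h.t_inv_pos
      have hp := h.pos
      have hM := h.one_le
      have h1 := hA' R hR
      have h2 := hB' R hR
      rw [squareInt_empty, norm_mul, norm_exp_two ht, norm_mul, RCLike.norm_conj]
      calc _ ≤ Real.exp 2 * (M ^ (a + 1) * (1 / δ) ^ (K - 1) *
            (M ^ (b + 1) * (1 / δ) ^ (P - 1))) := by gcongr
        _ = _ := by
          simp only [powerCount, Finset.sum_empty, Finset.card_empty, add_zero, pow_add (1 / δ)]
          ring
  · exact ⟨⟨_, tendsto_square_integral (h.integrable_planeIntegrand hK hP hs hkp huc hu)⟩,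
      fun R hR => h.norm_squareInt_le_of_nonempty hK hP hs hkp huc hu hR⟩

/-- Effect on the plane integrals of the replacement of the self-energy: a gain of `1 / t`. -/
theorem norm_squareInt_sub_le (h : SelfEnergyBounds δ t w θ M) (hK : 1 ≤ K) (hP : 1 ≤ P)
    (hkp : ∀ j ∈ s, 1 ≤ kk j ∧ 1 ≤ pp j) (ha : s = ∅ → 1 ≤ a → 2 ≤ K)
    (hb : s = ∅ → 1 ≤ b → 2 ≤ P) {R : ℝ} (hR : 0 ≤ R) :
    1 / δ * ‖squareInt t w K P a b s kk pp (fun α => selfEnergy α t⁻¹) R -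
        squareInt t w K P a b s kk pp (fun _ => θ) R‖ ≤
      2 * Real.exp 2 * (2 * M) ^ (a + b + s.card + 3) * (1 / δ) ^ powerCount K P s kk pp := by
  rcases s.eq_empty_or_nonempty with rfl | hs
  · simpa only [powerCount, Finset.sum_empty, Finset.card_empty, add_zero] using
      h.norm_squareInt_sub_le_of_empty hK hP (ha rfl) (hb rfl) hR
  · exact h.norm_squareInt_sub_le_of_nonempty hK hP hs hkp hR

end SelfEnergyBounds

end TwoSite

namespace TwoSite

/-- Exchange of a square integral with the integral over a finite measure. -/
theorem square_integral_swap (μ : Measure ℝ) [IsFiniteMeasure μ] {G : (ℝ × ℝ) × ℝ → ℂ}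
    (hG : StronglyMeasurable G) {C : ℝ} (hC : ∀ q, ‖G q‖ ≤ C) {R : ℝ} (hR : 0 ≤ R) :
    AEStronglyMeasurable
      (fun w => ∫ α in (-R)..R, ∫ β in (-R)..R, G ((α, β), w)) μ ∧
    ∫ α in (-R)..R, ∫ β in (-R)..R, ∫ w, G ((α, β), w) ∂μ =
      ∫ w, (∫ α in (-R)..R, ∫ β in (-R)..R, G ((α, β), w)) ∂μ := by
  have hle : -R ≤ R := by linarith
  simp only [intervalIntegral.integral_of_le hle]
  set ν : Measure ℝ := volume.restrict (Set.Ioc (-R) R) with hν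
  have hi : Integrable G ((ν.prod ν).prod μ) :=
    Integrable.of_bound hG.aestronglyMeasurable C (ae_of_all _ hC)
  have hw : ∀ w, Integrable (fun p : ℝ × ℝ => G (p, w)) (ν.prod ν) := fun w =>
    Integrable.of_bound (hG.comp_measurable (by fun_prop :
      Measurable fun p : ℝ × ℝ => (p, w))).aestronglyMeasurable C (ae_of_all _ fun p => hC _)
  have e1 : ∀ w, ∫ α, ∫ β, G ((α, β), w) ∂ν ∂ν = ∫ p, G (p, w) ∂(ν.prod ν) := fun w =>
    (integral_prod (fun p => G (p, w)) (hw w)).symm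
  have e2 := integral_prod (fun p : ℝ × ℝ => ∫ w, G (p, w) ∂μ) hi.integral_prod_left
  simp only [e1]
  refine ⟨hi.integral_prod_right.aestronglyMeasurable, ?_⟩
  rw [← e2]
  exact integral_integral_swap (f := fun p w => G (p, w)) hi

theorem selfEnergyBounds {ε t w : ℝ} (hε : 0 < ε) (ht : 0 < t) (hw : w ∈ Set.Ioo ε (1 - ε)) :
    SelfEnergyBounds (min 1 t⁻¹) t w (logSelfEnergy w)
      ((66 + (2 / ε + 12) * (2 + 4 / ε)) * logFactor (min 1 t⁻¹) *
        (t⁻¹ * (1 / min 1 t⁻¹))) := by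
  set δ := min 1 t⁻¹ with hδ
  have ht' : 0 < t⁻¹ := inv_pos.2 ht
  have hpos : 0 < δ := lt_min one_pos ht'
  have hle : δ ≤ t⁻¹ := min_le_right _ _
  have hL := one_le_logFactor hpos
  have hone : 1 ≤ t⁻¹ * (1 / δ) := by rw [mul_one_div, le_div_iff₀ hpos]; linarith
  have h1 : 0 < 2 / ε := by positivity
  have h2 : 0 < 4 / ε := by positivity
  set c := (2 / ε + 12) * (2 + 4 / ε) with hc
  have hc1 : 2 / ε + 4 ≤ c := by rw [hc]; nlinarith
  have hL' : logFactor δ ≤ logFactor δ * (t⁻¹ * (1 / δ)) :=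
    le_mul_of_one_le_right (by linarith) hone
  have hcL : ∀ d, 0 ≤ d → d ≤ 66 + c →
      d * logFactor δ ≤ (66 + c) * logFactor δ * (t⁻¹ * (1 / δ)) := fun d hd hdc => by
    rw [mul_assoc (66 + c)]
    exact mul_le_mul hdc hL' (by linarith) (by linarith)
  refine ⟨hpos, min_le_left _ _, hle, ⟨by linarith [hw.1], by linarith [hw.2]⟩, ?_, ?_, ?_, ?_⟩
  · refine mul_le_mul_of_nonneg_right ?_ (by positivity)
    exact mul_le_mul_of_nonneg_right (by linarith) (by linarith)
  · intro α
    refine (norm_selfEnergy_le hpos hle α).trans (le_trans ?_ (hcL 8 (by norm_num) (by linarith)))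
    exact mul_le_of_le_one_right (by positivity) (decay_le_one α)
  · refine (norm_logSelfEnergy_le hε hw).trans
      (le_trans ?_ (hcL (2 / ε + 4) (by linarith) (by linarith)))
    exact le_mul_of_one_le_right (by linarith) hL
  · intro α
    refine (norm_prop_mul_norm_selfEnergy_sub_le hε hpos hle hw α).trans ?_
    exact mul_le_mul_of_nonneg_right (hcL c (by linarith) (by linarith)) (decay_pos α).le

theorem stronglyMeasurable_logSelfEnergy : StronglyMeasurable logSelfEnergy := by
  have : Measurable logSelfEnergy := by
    unfold logSelfEnergy
    exact ((Complex.measurable_ofReal.clog).sub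
      ((measurable_const.sub Complex.measurable_ofReal).clog)).sub_const _
  exact this.stronglyMeasurable

section Average

variable {ι : Type*} {t : ℝ} {K P a b : ℕ} {s : Finset ι} {kk pp : ι → ℕ}

theorem stronglyMeasurable_planeIntegrand (ht : 0 < t) {u : ℝ → ℝ → ℂ}
    (hu : StronglyMeasurable fun q : ℝ × ℝ => u q.1 q.2) :
    StronglyMeasurable fun q : (ℝ × ℝ) × ℝ =>
      planeIntegrand t q.2 K P a b s kk pp (u q.2) q.1.1 q.1.2 := by
  have ht' : 0 < t⁻¹ := inv_pos.2 ht
  have h1 : Continuous fun q : (ℝ × ℝ) × ℝ => phase t q.1.1 q.1.2 :=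
    (continuous_phase t).comp continuous_fst
  have h2 : Continuous fun q : (ℝ × ℝ) × ℝ => prop q.1.1 t⁻¹ q.2 :=
    continuous_prop ht' (by fun_prop) (by fun_prop)
  have h3 : Continuous fun q : (ℝ × ℝ) × ℝ => propBar q.1.2 t⁻¹ q.2 :=
    continuous_propBar ht' (by fun_prop) (by fun_prop)
  have h4 : StronglyMeasurable fun q : (ℝ × ℝ) × ℝ => u q.2 q.1.1 :=
    hu.comp_measurable (by fun_prop : Measurable fun q : (ℝ × ℝ) × ℝ => (q.2, q.1.1))
  have h5 : StronglyMeasurable fun q : (ℝ × ℝ) × ℝ => (starRingEnd ℂ) (u q.2 q.1.2) :=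
    Complex.continuous_conj.comp_stronglyMeasurable
      (hu.comp_measurable (by fun_prop : Measurable fun q : (ℝ × ℝ) × ℝ => (q.2, q.1.2)))
  have h6 : Continuous fun q : (ℝ × ℝ) × ℝ => rungProd t⁻¹ s kk pp q.1.1 q.1.2 :=
    (continuous_finsetProd _ fun j _ => continuous_classIntegral ht' _ _ :
      Continuous fun p : ℝ × ℝ => rungProd t⁻¹ s kk pp p.1 p.2).comp continuous_fst
  exact h1.stronglyMeasurable.mul (((h2.pow K).mul (h3.pow P)).stronglyMeasurable.mul
    (((h4.pow a).mul (h5.pow b)).mul h6.stronglyMeasurable))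

theorem exists_norm_planeIntegrand_le (ht : 0 < t) {u : ℝ → ℝ → ℂ} {C : ℝ}
    (hu : ∀ w α, ‖u w α‖ ≤ C) :
    ∃ D, ∀ w α β, ‖planeIntegrand t w K P a b s kk pp (u w) α β‖ ≤ D := by
  have ht' : 0 < t⁻¹ := inv_pos.2 ht
  have hC : 0 ≤ C := (norm_nonneg _).trans (hu 0 0)
  refine ⟨Real.exp 2 * ((1 / t⁻¹) ^ K * (1 / t⁻¹) ^ P *
    (C ^ a * C ^ b * ∏ j ∈ s, (1 / t⁻¹) ^ (kk j + pp j))), fun w α β => ?_⟩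
  have h1 := norm_prop_le_inv ht' le_rfl α w
  have h2 := norm_prop_le_inv ht' le_rfl β w
  have h3 := hu w α
  have h4 := hu w β
  have h5 : ‖rungProd t⁻¹ s kk pp α β‖ ≤ ∏ j ∈ s, (1 / t⁻¹) ^ (kk j + pp j) := by
    rw [rungProd, norm_prod]
    exact Finset.prod_le_prod (fun _ _ => norm_nonneg _)
      fun j _ => norm_classIntegral_le_pow ht' le_rfl α β _ _
  simp only [planeIntegrand, norm_mul, norm_pow, RCLike.norm_conj, norm_propBar, norm_phase ht]
  gcongr

/-- The average of the plane integrals over the initial energy. -/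
theorem average_squareInt (μ : Measure ℝ) [IsFiniteMeasure μ] (ht : 0 < t) {u : ℝ → ℝ → ℂ}
    (hum : StronglyMeasurable fun q : ℝ × ℝ => u q.1 q.2) {C : ℝ} (hu : ∀ w α, ‖u w α‖ ≤ C)
    {R : ℝ} (hR : 0 ≤ R) :
    AEStronglyMeasurable (fun w => squareInt t w K P a b s kk pp (u w) R) μ ∧
    ∫ α in (-R)..R, ∫ β in (-R)..R, ∫ w, planeIntegrand t w K P a b s kk pp (u w) α β ∂μ =
      ∫ w, squareInt t w K P a b s kk pp (u w) R ∂μ := by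
  obtain ⟨D, hD⟩ := exists_norm_planeIntegrand_le (K := K) (P := P) (a := a) (b := b) (s := s)
    (kk := kk) (pp := pp) ht hu
  exact square_integral_swap μ (stronglyMeasurable_planeIntegrand ht hum)
    (fun q => hD q.2 q.1.1 q.1.2) hR

end Average

namespace Pairing

open Classical in
/-- The classes of the gates of the unprimed side. -/
noncomputable def leftGates {n m : ℕ} (π : Pairing n m) : Finset π.EnergyClass :=
  (Finset.univ.erase π.lastClass).filter fun c => π.leftMult c = 1 ∧ π.rightMult c = 0

open Classical in
/-- The classes of the gates of the primed side. -/
noncomputable def rightGates {n m : ℕ} (π : Pairing n m) : Finset π.EnergyClass :=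
  (Finset.univ.erase π.lastClass).filter fun c => π.leftMult c = 0 ∧ π.rightMult c = 1

open Classical in
/-- The classes with propagators of both kinds, besides that of `E_n`. -/
noncomputable def rungs {n m : ℕ} (π : Pairing n m) : Finset π.EnergyClass :=
  (Finset.univ.erase π.lastClass).filter fun c => 1 ≤ π.leftMult c ∧ 1 ≤ π.rightMult c

variable {n m : ℕ} {π : Pairing n m}

open Classical in
@[to_additive]
theorem IsSimple.prod_erase_lastClass (hπ : π.IsSimple) {N : Type*} [CommMonoid N]
    (f : π.EnergyClass → N) :
    ∏ c ∈ Finset.univ.erase π.lastClass, f c =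
      (∏ c ∈ π.leftGates, f c) * (∏ c ∈ π.rightGates, f c) * ∏ c ∈ π.rungs, f c := by
  have h0 : Disjoint π.leftGates π.rightGates := by
    rw [Finset.disjoint_left]
    intro c hc hc'
    simp only [leftGates, rightGates, Finset.mem_filter] at hc hc'
    omega
  have h1 : Disjoint (π.leftGates ∪ π.rightGates) π.rungs := by
    rw [Finset.disjoint_left]
    intro c hc hc'
    simp only [leftGates, rightGates, rungs, Finset.mem_union, Finset.mem_filter] at hc hc'
    omega
  rw [← Finset.prod_union h0, ← Finset.prod_union h1]
  congr 1
  ext c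
  simp only [leftGates, rightGates, rungs, Finset.mem_union, Finset.mem_filter]
  have h2 := fun h => (hπ.leftMult_eq_one_of_rightMult_eq_zero (c := c) h).1
  have h3 := fun h => (hπ.rightMult_eq_one_of_leftMult_eq_zero (c := c) h).1
  constructor
  · intro h
    by_cases hl : π.leftMult c = 0
    · exact Or.inl (Or.inr ⟨h, hl, h3 hl⟩)
    by_cases hr : π.rightMult c = 0
    · exact Or.inl (Or.inl ⟨h, h2 hr, hr⟩)
    exact Or.inr ⟨h, by omega, by omega⟩
  · rintro ((h | h) | h) <;> exact h.1

theorem IsSimple.two_mul_card (hπ : π.IsSimple) :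
    2 * (π.leftGates.card + π.rightGates.card + π.rungs.card) = n + m := by
  classical
  rw [← two_mul_card_erase_lastClass hπ.1]
  simp only [Finset.card_eq_sum_ones]
  rw [hπ.sum_erase_lastClass]

theorem IsSimple.powerCount_add (hπ : π.IsSimple) :
    powerCount (π.leftMult π.lastClass) (π.rightMult π.lastClass) π.rungs π.leftMult
      π.rightMult + (π.leftGates.card + π.rightGates.card + π.rungs.card) = n + m := by
  classical
  have h1 := π.sum_leftMult
  have h2 := π.sum_rightMult
  rw [← Finset.add_sum_erase _ _ (Finset.mem_univ π.lastClass), hπ.sum_erase_lastClass] at h1 h2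
  have hK := π.one_le_leftMult_lastClass
  have hP := hπ.one_le_rightMult_lastClass
  have l1 : ∑ c ∈ π.leftGates, π.leftMult c = π.leftGates.card := by
    rw [Finset.card_eq_sum_ones]
    exact Finset.sum_congr rfl fun c hc => (Finset.mem_filter.1 hc).2.1
  have l2 : ∑ c ∈ π.rightGates, π.leftMult c = 0 :=
    Finset.sum_eq_zero fun c hc => (Finset.mem_filter.1 hc).2.1
  have r1 : ∑ c ∈ π.leftGates, π.rightMult c = 0 :=
    Finset.sum_eq_zero fun c hc => (Finset.mem_filter.1 hc).2.2
  have r2 : ∑ c ∈ π.rightGates, π.rightMult c = π.rightGates.card := by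
    rw [Finset.card_eq_sum_ones]
    exact Finset.sum_congr rfl fun c hc => (Finset.mem_filter.1 hc).2.2
  have h3 : ∑ c ∈ π.rungs, (π.leftMult c - 1 + (π.rightMult c - 1)) + 2 * π.rungs.card =
      ∑ c ∈ π.rungs, π.leftMult c + ∑ c ∈ π.rungs, π.rightMult c := by
    rw [Finset.card_eq_sum_ones, Finset.mul_sum, ← Finset.sum_add_distrib,
      ← Finset.sum_add_distrib]
    refine Finset.sum_congr rfl fun c hc => ?_
    have := (Finset.mem_filter.1 hc).2
    omega
  unfold powerCount
  omega

theorem IsSimple.powerCount_eq (hπ : π.IsSimple) :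
    powerCount (π.leftMult π.lastClass) (π.rightMult π.lastClass) π.rungs π.leftMult
      π.rightMult = (n + m) / 2 := by
  have h1 := hπ.powerCount_add
  have h2 := hπ.two_mul_card
  omega

theorem IsSimple.two_le_leftMult_lastClass (hπ : π.IsSimple) (hs : π.rungs = ∅)
    (ha : 1 ≤ π.leftGates.card) : 2 ≤ π.leftMult π.lastClass := by
  classical
  obtain ⟨c, hc⟩ := Finset.card_pos.1 ha
  obtain ⟨c', hc'⟩ :=
    (hπ.leftMult_eq_one_of_rightMult_eq_zero (Finset.mem_filter.1 hc).2.2).2.2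
  by_cases h : c' = π.lastClass
  · rwa [h] at hc'
  have hr : π.rightMult c' ≠ 0 := fun h0 => by
    have := (hπ.leftMult_eq_one_of_rightMult_eq_zero h0).1
    omega
  have : c' ∈ π.rungs := Finset.mem_filter.2
    ⟨Finset.mem_erase.2 ⟨h, Finset.mem_univ _⟩, by omega, by omega⟩
  rw [hs] at this
  simp at this

theorem IsSimple.two_le_rightMult_lastClass (hπ : π.IsSimple) (hs : π.rungs = ∅)
    (hb : 1 ≤ π.rightGates.card) : 2 ≤ π.rightMult π.lastClass := by
  classical
  obtain ⟨c, hc⟩ := Finset.card_pos.1 hb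
  obtain ⟨c', hc'⟩ :=
    (hπ.rightMult_eq_one_of_leftMult_eq_zero (Finset.mem_filter.1 hc).2.1).2
  by_cases h : c' = π.lastClass
  · rwa [h] at hc'
  have hr : π.leftMult c' ≠ 0 := fun h0 => by
    have := (hπ.rightMult_eq_one_of_leftMult_eq_zero h0).1
    omega
  have : c' ∈ π.rungs := Finset.mem_filter.2
    ⟨Finset.mem_erase.2 ⟨h, Finset.mem_univ _⟩, by omega, by omega⟩
  rw [hs] at this
  simp at this

open Classical in
/-- The product over the independent variables, with a function `u` in place of the
self-energy. -/
theorem IsSimple.prod_eq (hπ : π.IsSimple) (η : ℝ) (u : ℝ → ℂ) (α β : ℝ)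
    (f : π.EnergyClass → ℂ)
    (hl : ∀ c, π.leftMult c = 1 ∧ π.rightMult c = 0 → f c = u α)
    (hr : ∀ c, π.leftMult c = 0 ∧ π.rightMult c = 1 → f c = (starRingEnd ℂ) (u β))
    (hf : ∀ c, 1 ≤ π.leftMult c ∧ 1 ≤ π.rightMult c →
      f c = classIntegral α β η (π.leftMult c) (π.rightMult c)) :
    ∏ c ∈ Finset.univ.erase π.lastClass, f c =
      u α ^ π.leftGates.card * (starRingEnd ℂ) (u β) ^ π.rightGates.card *
        rungProd η π.rungs π.leftMult π.rightMult α β := by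
  rw [hπ.prod_erase_lastClass]
  congr 1
  · congr 1
    · exact Finset.prod_eq_pow_card fun c hc => hl c (Finset.mem_filter.1 hc).2
    · exact Finset.prod_eq_pow_card fun c hc => hr c (Finset.mem_filter.1 hc).2
  · exact Finset.prod_congr rfl fun c hc => hf c (Finset.mem_filter.1 hc).2

end Pairing

end TwoSite

namespace TwoSite

namespace IsInitialDistribution

variable {ε : ℝ} {P0 : Fin 2 → Measure ℝ}

theorem exists_initialAt_eq (P0 : Fin 2 → Measure ℝ) (x : Fin 2) (n : ℕ) :
    ∃ y, initialAt P0 x n = P0 y := by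
  unfold initialAt
  split_ifs
  exacts [⟨_, rfl⟩, ⟨_, rfl⟩]

theorem initialAt_univ_le (hP : IsInitialDistribution ε P0) (x : Fin 2) (n : ℕ) :
    initialAt P0 x n Set.univ ≤ 1 := by
  obtain ⟨y, hy⟩ := exists_initialAt_eq P0 x n
  rw [hy, ← hP.total_mass]
  fin_cases y
  · exact le_self_add
  · exact le_add_self

theorem isFiniteMeasure_initialAt (hP : IsInitialDistribution ε P0) (x : Fin 2) (n : ℕ) :
    IsFiniteMeasure (initialAt P0 x n) :=
  ⟨(hP.initialAt_univ_le x n).trans_lt ENNReal.one_lt_top⟩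

theorem real_initialAt_univ_le (hP : IsInitialDistribution ε P0) (x : Fin 2) (n : ℕ) :
    (initialAt P0 x n).real Set.univ ≤ 1 :=
  ENNReal.toReal_le_of_le_ofReal zero_le_one (by simpa using hP.initialAt_univ_le x n)

theorem ae_mem_Ioo (hP : IsInitialDistribution ε P0) (x : Fin 2) (n : ℕ) :
    ∀ᵐ w ∂(initialAt P0 x n), w ∈ Set.Ioo ε (1 - ε) := by
  obtain ⟨y, hy⟩ := exists_initialAt_eq P0 x n
  rw [hy]
  refine measure_mono_null (fun w hw => ?_) (hP.edges y)
  by_contra h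
  refine hw ⟨?_, ?_⟩
  · by_contra h'; exact h (Or.inl (not_lt.1 h'))
  · by_contra h'; exact h (Or.inr (not_lt.1 h'))

end IsInitialDistribution

/-- The boundary value of the self-energy, cut off at the edges of the spectrum. -/
noncomputable def cutSelfEnergy (ε : ℝ) : ℝ → ℂ := (Set.Ioo ε (1 - ε)).indicator logSelfEnergy

theorem stronglyMeasurable_cutSelfEnergy (ε : ℝ) : StronglyMeasurable (cutSelfEnergy ε) :=
  stronglyMeasurable_logSelfEnergy.indicator measurableSet_Ioo

theorem norm_cutSelfEnergy_le {ε : ℝ} (hε : 0 < ε) (w : ℝ) : ‖cutSelfEnergy ε w‖ ≤ 2 / ε + 4 := by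
  by_cases hw : w ∈ Set.Ioo ε (1 - ε)
  · rw [cutSelfEnergy, Set.indicator_of_mem hw]
    exact norm_logSelfEnergy_le hε hw
  · rw [cutSelfEnergy, Set.indicator_of_notMem hw, norm_zero]
    positivity

theorem cutSelfEnergy_eq {ε w : ℝ} (hw : w ∈ Set.Ioo ε (1 - ε)) :
    cutSelfEnergy ε w = logSelfEnergy w := Set.indicator_of_mem hw _

theorem cutSelfEnergy_eq_boundary {ε w : ℝ} (hε : 0 < ε) (hw : w ∈ Set.Ioo ε (1 - ε)) :
    cutSelfEnergy ε w = boundarySelfEnergy w := by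
  rw [cutSelfEnergy_eq hw, boundarySelfEnergy_eq ⟨hε.trans hw.1, by linarith [hw.2]⟩]

/-- The square integral of a graph at fixed initial energy, with a function `u` in place of the
self-energy. -/
noncomputable def graphInt {n m : ℕ} (π : Pairing n m) (t : ℝ) (u : ℝ → ℝ → ℂ) (R w : ℝ) : ℂ :=
  squareInt t w (π.leftMult π.lastClass) (π.rightMult π.lastClass) π.leftGates.card
    π.rightGates.card π.rungs π.leftMult π.rightMult (u w) R

variable {n m : ℕ} {π : Pairing n m} {ε t lam R : ℝ} {P0 : Fin 2 → Measure ℝ} {x : Fin 2}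

theorem norm_selfEnergy_le_const (ht : 0 < t) (α : ℝ) : ‖selfEnergy α t⁻¹‖ ≤ 1 / t⁻¹ := by
  rw [← classIntegral_one_zero α 0]
  simpa using norm_classIntegral_le_pow (inv_pos.2 ht) le_rfl α 0 1 0

open Classical in
theorem truncatedAlphaRep_eq (hP : IsInitialDistribution ε P0) (ht : 0 < t)
    {F : ℝ → ℝ → ℝ → π.EnergyClass → ℂ} {u : ℝ → ℝ → ℂ}
    (hum : StronglyMeasurable fun q : ℝ × ℝ => u q.1 q.2) {C : ℝ} (hu : ∀ w α, ‖u w α‖ ≤ C)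
    (hF : ∀ w ∈ Set.Ioo ε (1 - ε), ∀ α β, ∏ c ∈ Finset.univ.erase π.lastClass, F w α β c =
      u w α ^ π.leftGates.card * (starRingEnd ℂ) (u w β) ^ π.rightGates.card *
        rungProd t⁻¹ π.rungs π.leftMult π.rightMult α β) (hR : 0 ≤ R) :
    truncatedAlphaRep P0 π x t lam F R = (lam : ℂ) ^ (n + m) * (1 / (2 * (Real.pi : ℂ)) ^ 2) *
      ∫ w, graphInt π t u R w ∂(initialAt P0 x n) := by
  have := hP.isFiniteMeasure_initialAt x n
  unfold graphInt
  rw [truncatedAlphaRep, ← (average_squareInt (initialAt P0 x n) ht hum hu hR).2]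
  congr 1
  refine intervalIntegral.integral_congr fun α _ => intervalIntegral.integral_congr fun β _ => ?_
  rw [← integral_const_mul]
  refine integral_congr_ae ?_
  filter_upwards [hP.ae_mem_Ioo x n] with w hw
  rw [hF w hw, planeIntegrand, phase]

theorem stronglyMeasurable_selfEnergy (ht : 0 < t) :
    StronglyMeasurable fun q : ℝ × ℝ => selfEnergy q.2 t⁻¹ :=
  ((continuous_selfEnergy (inv_pos.2 ht)).comp continuous_snd).stronglyMeasurable

theorem QTrunc_eq (hP : IsInitialDistribution ε P0) (hπ : π.IsSimple) (ht : 0 < t)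
    (hR : 0 ≤ R) : QTrunc P0 π x t lam R =
      (lam : ℂ) ^ (n + m) * (1 / (2 * (Real.pi : ℂ)) ^ 2) *
        ∫ w, graphInt π t (fun _ α => selfEnergy α t⁻¹) R w ∂(initialAt P0 x n) := by
  refine truncatedAlphaRep_eq hP ht (stronglyMeasurable_selfEnergy ht)
    (fun _ α => norm_selfEnergy_le_const ht α) (fun w _ α β => ?_) hR
  refine hπ.prod_eq t⁻¹ (fun α => selfEnergy α t⁻¹) α β _ (fun c hc => ?_) (fun c hc => ?_)
    (fun c hc => rfl)
  · rw [hc.1, hc.2, classIntegral_one_zero]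
  · rw [hc.1, hc.2, classIntegral_zero_one]

theorem QTildeTrunc_eq (hε : 0 < ε) (hP : IsInitialDistribution ε P0) (hπ : π.IsSimple)
    (ht : 0 < t) (hR : 0 ≤ R) : QTildeTrunc P0 π x t lam R =
      (lam : ℂ) ^ (n + m) * (1 / (2 * (Real.pi : ℂ)) ^ 2) *
        ∫ w, graphInt π t (fun w _ => cutSelfEnergy ε w) R w ∂(initialAt P0 x n) := by
  refine truncatedAlphaRep_eq hP ht
    ((stronglyMeasurable_cutSelfEnergy ε).comp_measurable measurable_fst)
    (fun w _ => norm_cutSelfEnergy_le hε w) (fun w hw α β => ?_) hR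
  refine hπ.prod_eq t⁻¹ (fun _ => cutSelfEnergy ε w) α β _ (fun c hc => ?_) (fun c hc => ?_)
    (fun c hc => ?_)
  · rw [replacedClassIntegral, if_pos hc, cutSelfEnergy_eq_boundary hε hw]
  · rw [replacedClassIntegral, if_neg (by omega), if_pos hc, cutSelfEnergy_eq_boundary hε hw]
  · rw [replacedClassIntegral, if_neg (by omega), if_neg (by omega)]

/-- Convergence and uniform boundedness of the square integrals of a graph. -/
theorem graphInt_spec (hε : 0 < ε) (hπ : π.IsSimple) (ht : 0 < t) {u : ℝ → ℝ → ℂ}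
    (huc : ∀ w, Continuous (u w)) (huM : ∀ {w : ℝ} {δ M : ℝ}, w ∈ Set.Ioo ε (1 - ε) →
      SelfEnergyBounds δ t w (logSelfEnergy w) M → ∀ α, ‖u w α‖ ≤ M) :
    ∃ B, ∀ w ∈ Set.Ioo ε (1 - ε), (∃ S, Tendsto (fun R => graphInt π t u R w) atTop (𝓝 S)) ∧
      ∀ R, 0 ≤ R → ‖graphInt π t u R w‖ ≤ B :=
  ⟨_, fun w hw => (selfEnergyBounds hε ht hw).squareInt_spec (s := π.rungs)
    π.one_le_leftMult_lastClass hπ.one_le_rightMult_lastClass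
    (fun _ hc => (Finset.mem_filter.1 hc).2) (hπ.two_le_leftMult_lastClass)
    (hπ.two_le_rightMult_lastClass) (huc w) (huM hw (selfEnergyBounds hε ht hw))⟩

/-- Convergence of the averaged square integrals. -/
theorem tendsto_integral_graphInt (hε : 0 < ε) (hP : IsInitialDistribution ε P0)
    (hπ : π.IsSimple) (ht : 0 < t) {u : ℝ → ℝ → ℂ}
    (hum : StronglyMeasurable fun q : ℝ × ℝ => u q.1 q.2) {C : ℝ} (hu : ∀ w α, ‖u w α‖ ≤ C)
    (huc : ∀ w, Continuous (u w)) (huM : ∀ {w : ℝ} {δ M : ℝ}, w ∈ Set.Ioo ε (1 - ε) →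
      SelfEnergyBounds δ t w (logSelfEnergy w) M → ∀ α, ‖u w α‖ ≤ M) :
    ∃ S, Tendsto (fun R => ∫ w, graphInt π t u R w ∂(initialAt P0 x n)) atTop (𝓝 S) := by
  have := hP.isFiniteMeasure_initialAt x n
  obtain ⟨B, hB⟩ := graphInt_spec hε hπ ht huc huM
  refine ⟨_, tendsto_integral_filter_of_dominated_convergence
    (f := fun w => limUnder atTop fun R => graphInt π t u R w) (fun _ => B) ?_ ?_
    (integrable_const _) ?_⟩
  · filter_upwards [eventually_ge_atTop 0] with R hR
    exact (average_squareInt (initialAt P0 x n) ht hum hu hR).1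
  · filter_upwards [eventually_ge_atTop 0] with R hR
    filter_upwards [hP.ae_mem_Ioo x n] with w hw
    exact (hB w hw).2 R hR
  · filter_upwards [hP.ae_mem_Ioo x n] with w hw
    exact tendsto_nhds_limUnder (hB w hw).1

theorem tendsto_QTrunc (hε : 0 < ε) (hP : IsInitialDistribution ε P0) (hπ : π.IsSimple)
    (ht : 0 < t) : Tendsto (QTrunc P0 π x t lam) atTop (𝓝 (Q P0 π x t lam)) := by
  obtain ⟨S, hS⟩ := tendsto_integral_graphInt (x := x) hε hP hπ ht
    (stronglyMeasurable_selfEnergy ht) (fun _ α => norm_selfEnergy_le_const ht α)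
    (fun _ => continuous_selfEnergy (inv_pos.2 ht)) fun _ h => h.norm_le
  have h := hS.const_mul ((lam : ℂ) ^ (n + m) * (1 / (2 * (Real.pi : ℂ)) ^ 2))
  refine tendsto_nhds_limUnder ⟨_, h.congr' ?_⟩
  filter_upwards [eventually_ge_atTop 0] with R hR
  exact (QTrunc_eq hP hπ ht hR).symm

theorem tendsto_QTildeTrunc (hε : 0 < ε) (hP : IsInitialDistribution ε P0) (hπ : π.IsSimple)
    (ht : 0 < t) : Tendsto (QTildeTrunc P0 π x t lam) atTop (𝓝 (QTilde P0 π x t lam)) := by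
  obtain ⟨S, hS⟩ := tendsto_integral_graphInt (x := x) hε hP hπ ht
    ((stronglyMeasurable_cutSelfEnergy ε).comp_measurable measurable_fst)
    (fun w _ => norm_cutSelfEnergy_le hε w) (fun _ => continuous_const)
    fun hw h _ => by rw [cutSelfEnergy_eq hw]; exact h.norm_boundary_le
  have h := hS.const_mul ((lam : ℂ) ^ (n + m) * (1 / (2 * (Real.pi : ℂ)) ^ 2))
  refine tendsto_nhds_limUnder ⟨_, h.congr' ?_⟩
  filter_upwards [eventually_ge_atTop 0] with R hR
  exact (QTildeTrunc_eq hε hP hπ ht hR).symm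

/-- The constant in the estimates of the self-energy. -/
noncomputable def energyConst (ε : ℝ) : ℝ := 12 * (66 + (2 / ε + 12) * (2 + 4 / ε))

theorem one_le_energyConst (hε : 0 < ε) : 1 ≤ energyConst ε := by
  have h1 : 0 < 2 / ε := by positivity
  have h2 : 0 < 4 / ε := by positivity
  unfold energyConst
  nlinarith

theorem norm_graphInt_sub_le (hε : 0 < ε) (hπ : π.IsSimple) (ht : 2 ≤ t) {w : ℝ}
    (hw : w ∈ Set.Ioo ε (1 - ε)) (hR : 0 ≤ R) :
    t * ‖graphInt π t (fun _ α => selfEnergy α t⁻¹) R w -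
        graphInt π t (fun w _ => cutSelfEnergy ε w) R w‖ ≤
      2 * Real.exp 2 * (energyConst ε * Real.log t) ^ ((n + m) / 2 + 3) * t ^ ((n + m) / 2) := by
  have ht0 : 0 < t := by linarith
  have hmin : min 1 t⁻¹ = t⁻¹ := min_eq_right (inv_le_one_of_one_le₀ (by linarith))
  have h := selfEnergyBounds hε ht0 hw
  rw [hmin, one_div, inv_inv, inv_mul_cancel₀ ht0.ne', mul_one] at h
  have h1 := h.norm_squareInt_sub_le (s := π.rungs) π.one_le_leftMult_lastClass
    hπ.one_le_rightMult_lastClass (fun c hc => (Finset.mem_filter.1 hc).2)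
    (hπ.two_le_leftMult_lastClass) (hπ.two_le_rightMult_lastClass) hR
  have hcard : π.leftGates.card + π.rightGates.card + π.rungs.card = (n + m) / 2 := by
    have := hπ.two_mul_card; omega
  rw [hπ.powerCount_eq, hcard, one_div, inv_inv] at h1
  unfold graphInt
  beta_reduce
  rw [cutSelfEnergy_eq hw]
  refine h1.trans ?_
  have hlog : logFactor t⁻¹ ≤ 6 * Real.log t := by
    have := logFactor_le (inv_pos.2 ht0) (by
      rw [one_div]; exact inv_anti₀ (by norm_num) ht)
    rwa [one_div, inv_inv] at this
  have hM : 2 * ((66 + (2 / ε + 12) * (2 + 4 / ε)) * logFactor t⁻¹) ≤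
      energyConst ε * Real.log t := by
    have hc : 0 ≤ 66 + (2 / ε + 12) * (2 + 4 / ε) := by positivity
    have := mul_le_mul_of_nonneg_left hlog hc
    unfold energyConst
    linarith
  have h2 := h.one_le
  have := Real.exp_pos 2
  gcongr

theorem norm_QTrunc_sub_le (hε : 0 < ε) (hP : IsInitialDistribution ε P0) (hπ : π.IsSimple)
    (ht : 2 ≤ t) (hR : 0 ≤ R) :
    t * ‖QTrunc P0 π x t lam R - QTildeTrunc P0 π x t lam R‖ ≤
      (lam ^ 2 * t) ^ ((n + m) / 2) *
        (energyConst ε * Real.log t) ^ ((n + m) / 2 + 3) := by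
  have ht0 : 0 < t := by linarith
  have := hP.isFiniteMeasure_initialAt x n
  have hk : n + m = 2 * ((n + m) / 2) := by have := hπ.two_mul_card; omega
  have hint : ∀ u : ℝ → ℝ → ℂ, StronglyMeasurable (fun q : ℝ × ℝ => u q.1 q.2) →
      (∀ {w : ℝ} {δ M : ℝ}, w ∈ Set.Ioo ε (1 - ε) →
        SelfEnergyBounds δ t w (logSelfEnergy w) M → ∀ α, ‖u w α‖ ≤ M) →
      (∀ w, Continuous (u w)) → ∀ C, (∀ w α, ‖u w α‖ ≤ C) →
      Integrable (graphInt π t u R) (initialAt P0 x n) := by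
    intro u hum huM huc C hu
    obtain ⟨B, hB⟩ := graphInt_spec (π := π) hε hπ ht0 huc huM
    refine Integrable.of_bound (average_squareInt (initialAt P0 x n) ht0 hum hu hR).1 B ?_
    filter_upwards [hP.ae_mem_Ioo x n] with w hw
    exact (hB w hw).2 R hR
  have hi1 := hint _ (stronglyMeasurable_selfEnergy ht0) (fun _ h => h.norm_le)
    (fun _ => continuous_selfEnergy (inv_pos.2 ht0)) _ fun _ α => norm_selfEnergy_le_const ht0 α
  have hi2 := hint _ ((stronglyMeasurable_cutSelfEnergy ε).comp_measurable measurable_fst)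
    (fun hw h _ => by rw [cutSelfEnergy_eq hw]; exact h.norm_boundary_le)
    (fun _ => continuous_const) _ fun w _ => norm_cutSelfEnergy_le hε w
  set B := 2 * Real.exp 2 * (energyConst ε * Real.log t) ^ ((n + m) / 2 + 3) *
    t ^ ((n + m) / 2) with hB
  have hlog : 0 ≤ Real.log t := Real.log_nonneg (by linarith)
  have hc := one_le_energyConst hε
  have hB0 : 0 ≤ B := by positivity
  have h1 : t * ‖∫ w, (graphInt π t (fun _ α => selfEnergy α t⁻¹) R w -
      graphInt π t (fun w _ => cutSelfEnergy ε w) R w) ∂(initialAt P0 x n)‖ ≤ B := by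
    have h2 : ∀ᵐ w ∂(initialAt P0 x n), ‖graphInt π t (fun _ α => selfEnergy α t⁻¹) R w -
        graphInt π t (fun w _ => cutSelfEnergy ε w) R w‖ ≤ B / t := by
      filter_upwards [hP.ae_mem_Ioo x n] with w hw
      rw [le_div_iff₀' ht0]
      exact norm_graphInt_sub_le hε hπ ht hw hR
    have h3 := norm_integral_le_of_norm_le_const h2
    have h4 := mul_le_of_le_one_right (by positivity : 0 ≤ B / t)
      (hP.real_initialAt_univ_le x n)
    rw [← le_div_iff₀' ht0]
    exact h3.trans h4
  rw [QTrunc_eq hP hπ ht0 hR, QTildeTrunc_eq hε hP hπ ht0 hR, ← mul_sub, ← integral_sub hi1 hi2,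
    norm_mul, norm_mul, norm_pow, Complex.norm_real]
  have hlam : ‖lam‖ ^ (n + m) = (lam ^ 2) ^ ((n + m) / 2) := by
    conv_lhs => rw [hk]
    rw [pow_mul, Real.norm_eq_abs, sq_abs]
  have hpi : ‖(1 / (2 * (Real.pi : ℂ)) ^ 2)‖ = 1 / (2 * Real.pi) ^ 2 := by
    rw [norm_div, norm_one, norm_pow, norm_mul, Complex.norm_real,
      Real.norm_of_nonneg Real.pi_pos.le]
    simp
  have hnum : 1 / (2 * Real.pi) ^ 2 * (2 * Real.exp 2) ≤ 1 := by
    have e : Real.exp 2 = Real.exp 1 ^ 2 := by rw [← Real.exp_nat_mul]; norm_num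
    have h5 := Real.exp_one_lt_d9
    have h6 := Real.pi_gt_three
    have h7 : Real.exp 1 ^ 2 ≤ 3 ^ 2 := pow_le_pow_left₀ (Real.exp_pos 1).le (by linarith) 2
    rw [one_div, inv_mul_le_iff₀ (by positivity), e]
    nlinarith
  rw [hlam, hpi]
  set J := ‖∫ w, (graphInt π t (fun _ α => selfEnergy α t⁻¹) R w -
      graphInt π t (fun w _ => cutSelfEnergy ε w) R w) ∂(initialAt P0 x n)‖
  calc _ = (lam ^ 2) ^ ((n + m) / 2) * (1 / (2 * Real.pi) ^ 2) * (t * J) := by ring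
    _ ≤ (lam ^ 2) ^ ((n + m) / 2) * (1 / (2 * Real.pi) ^ 2) * B := by gcongr
    _ = (1 / (2 * Real.pi) ^ 2 * (2 * Real.exp 2)) * ((lam ^ 2 * t) ^ ((n + m) / 2) *
        (energyConst ε * Real.log t) ^ ((n + m) / 2 + 3)) := by rw [hB, mul_pow (lam ^ 2)]; ring
    _ ≤ _ := mul_le_of_le_one_left (by positivity) hnum

theorem Q_eq_QTilde_of_zero {π : Pairing 0 0} (hπ : π.IsSimple) :
    Q P0 π x t lam = QTilde P0 π x t lam := by
  classical
  have h : Finset.univ.erase π.lastClass = ∅ := by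
    have := Pairing.two_mul_card_erase_lastClass hπ.1
    rw [← Finset.card_eq_zero]
    convert (by omega : (Finset.univ.erase π.lastClass).card = 0)
  have : QTrunc P0 π x t lam = QTildeTrunc P0 π x t lam := by
    ext R
    simp only [QTrunc, QTildeTrunc, truncatedAlphaRep]
    congr 1
    refine intervalIntegral.integral_congr fun α _ => intervalIntegral.integral_congr fun β _ => ?_
    congr 2
    ext w
    congr 1
    convert (Finset.prod_empty.trans Finset.prod_empty.symm : ∏ c ∈ (∅ : Finset π.EnergyClass),
      classIntegral α β t⁻¹ (π.leftMult c) (π.rightMult c) = ∏ c ∈ (∅ : Finset π.EnergyClass),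
      replacedClassIntegral w α β t⁻¹ (π.leftMult c) (π.rightMult c))
  rw [Q, QTilde, this]

/-- The bound on the effect of the replacement for a simple graph. -/
theorem norm_Q_sub_QTilde_le (hε : 0 < ε) (hP : IsInitialDistribution ε P0) (hπ : π.IsSimple)
    (ht : 2 ≤ t) :
    ‖Q P0 π x t lam - QTilde P0 π x t lam‖ ≤
      (4 * energyConst ε ^ 4 * (lam ^ 2 * t)) ^ ((n + m) / 2) *
        Real.log t ^ ((n + m) / 2 + 5) / t := by
  have ht0 : 0 < t := by linarith
  have hc := one_le_energyConst hε
  have hlog : 1 / 2 ≤ Real.log t := by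
    have := Real.log_le_log (by norm_num) ht
    linarith [Real.log_two_gt_d9]
  by_cases h0 : n + m = 0
  · obtain ⟨rfl, rfl⟩ : n = 0 ∧ m = 0 := by omega
    rw [Q_eq_QTilde_of_zero hπ, sub_self, norm_zero]
    positivity
  have hk : 1 ≤ (n + m) / 2 := by have := hπ.two_mul_card; omega
  rw [le_div_iff₀' ht0]
  have h1 : t * ‖Q P0 π x t lam - QTilde P0 π x t lam‖ ≤ (lam ^ 2 * t) ^ ((n + m) / 2) *
        (energyConst ε * Real.log t) ^ ((n + m) / 2 + 3) := by
    refine le_of_tendsto (((tendsto_QTrunc hε hP hπ ht0).sub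
      (tendsto_QTildeTrunc hε hP hπ ht0)).norm.const_mul t) ?_
    filter_upwards [eventually_ge_atTop 0] with R hR
    exact norm_QTrunc_sub_le hε hP hπ ht hR
  refine h1.trans ?_
  set k := (n + m) / 2
  set D := energyConst ε
  set l := Real.log t
  have h2 : D ^ (k + 3) ≤ (D ^ 4) ^ k := by
    rw [← pow_mul]; exact pow_le_pow_right₀ hc (by omega)
  have h3 : (4 : ℝ) ≤ 4 ^ k := le_self_pow₀ (by norm_num) (by omega)
  have h4 : l ^ (k + 3) ≤ 4 * l ^ (k + 5) := by
    have : 1 ≤ 4 * l ^ 2 := by nlinarith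
    calc l ^ (k + 3) ≤ l ^ (k + 3) * (4 * l ^ 2) := le_mul_of_one_le_right (by positivity) this
      _ = _ := by ring
  calc (lam ^ 2 * t) ^ k * (D * l) ^ (k + 3)
      = (lam ^ 2 * t) ^ k * (D ^ (k + 3) * l ^ (k + 3)) := by rw [mul_pow D]
    _ ≤ (lam ^ 2 * t) ^ k * ((D ^ 4) ^ k * (4 ^ k * l ^ (k + 5))) := by
        have : l ^ (k + 3) ≤ 4 ^ k * l ^ (k + 5) := h4.trans (by gcongr)
        gcongr
    _ = _ := by rw [mul_pow (4 * D ^ 4), mul_pow 4]; ring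

/-- The Van Hove limit of the effect of the replacement for a simple graph. -/
theorem tendsto_QTilde_sub_Q (hε : 0 < ε) (hP : IsInitialDistribution ε P0) (hπ : π.IsSimple)
    {T : ℝ} {lam : ℝ → ℝ} (hlam : ∀ t, 0 < t → lam t ^ 2 * t = T) :
    Tendsto (fun t => QTilde P0 π x t (lam t) - Q P0 π x t (lam t)) atTop (𝓝 0) := by
  have h1 : Tendsto (fun t : ℝ => (4 * energyConst ε ^ 4 * T) ^ ((n + m) / 2) *
      (Real.log t ^ ((n + m) / 2 + 5) / t)) atTop (𝓝 0) := by
    have := (Real.isLittleO_pow_log_id_atTop (n := (n + m) / 2 + 5)).tendsto_div_nhds_zero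
    simpa using this.const_mul ((4 * energyConst ε ^ 4 * T) ^ ((n + m) / 2))
  refine squeeze_zero_norm' ?_ h1
  filter_upwards [eventually_ge_atTop 2] with t ht
  rw [norm_sub_rev, ← hlam t (by linarith), ← mul_div_assoc]
  exact norm_Q_sub_QTilde_le hε hP hπ ht

end TwoSite

theorem mainTheorem4 (ε : ℝ) (hε : 0 < ε) :
    -- the boundary values of the self-energy exist
    (∀ ω ∈ Set.Ioo (0 : ℝ) 1, Filter.Tendsto (fun η => TwoSite.selfEnergy ω η)
      (nhdsWithin 0 (Set.Ioi 0)) (nhds (TwoSite.boundarySelfEnergy ω))) ∧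
    -- the improper integrals defining `Q_π` and `Q̃_π` converge
    (∀ P0 : Fin 2 → MeasureTheory.Measure ℝ, TwoSite.IsInitialDistribution ε P0 →
      ∀ (n m : ℕ) (π : TwoSite.Pairing n m), π.IsSimple → ∀ (x : Fin 2) (t lam : ℝ), 0 < t →
        Filter.Tendsto (TwoSite.QTrunc P0 π x t lam) Filter.atTop
            (nhds (TwoSite.Q P0 π x t lam)) ∧
          Filter.Tendsto (TwoSite.QTildeTrunc P0 π x t lam) Filter.atTop
            (nhds (TwoSite.QTilde P0 π x t lam))) ∧
    -- the bound for each simple graph, with `T = λ² t` and `C` depending on `ε` only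
    (∃ C : ℝ, 0 < C ∧
      ∀ P0 : Fin 2 → MeasureTheory.Measure ℝ, TwoSite.IsInitialDistribution ε P0 →
        ∀ (n m : ℕ) (π : TwoSite.Pairing n m), π.IsSimple →
          ∀ (x : Fin 2) (T t lam : ℝ), 2 ≤ t → lam ^ 2 * t = T →
            ‖TwoSite.Q P0 π x t lam - TwoSite.QTilde P0 π x t lam‖ ≤
              (C * T) ^ ((n + m) / 2) * Real.log t ^ ((n + m) / 2 + 5) / t) ∧
    -- the Van Hove limit
    (∀ P0 : Fin 2 → MeasureTheory.Measure ℝ, TwoSite.IsInitialDistribution ε P0 →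
      ∀ (M : ℕ) (x : Fin 2) (T : ℝ) (lam : ℝ → ℝ), (∀ t, 0 < t → lam t ^ 2 * t = T) →
        Filter.Tendsto
          (fun t => TwoSite.simpleProbTilde P0 M x t (lam t) - TwoSite.simpleProb P0 M x t (lam t))
          Filter.atTop (nhds 0)) := by
  refine ⟨fun ω hω => ?_, fun P0 hP n m π hπ x t lam ht => ⟨TwoSite.tendsto_QTrunc hε hP hπ ht,
    TwoSite.tendsto_QTildeTrunc hε hP hπ ht⟩, ⟨4 * TwoSite.energyConst ε ^ 4, ?_, ?_⟩, ?_⟩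
  · rw [TwoSite.boundarySelfEnergy_eq hω]
    exact TwoSite.tendsto_selfEnergy hω
  · have := TwoSite.one_le_energyConst hε
    positivity
  · rintro P0 hP n m π hπ x _ t lam ht rfl
    exact TwoSite.norm_Q_sub_QTilde_le hε hP hπ ht
  · classical
    intro P0 hP M x T lam hlam
    simp only [TwoSite.simpleProbTilde, TwoSite.simpleProb, ← Finset.sum_sub_distrib]
    rw [← Finset.sum_const_zero (s := Finset.range (M + 1))]
    refine tendsto_finsetSum _ fun n _ => ?_
    rw [← Finset.sum_const_zero (s := Finset.range (M + 1))]
    refine tendsto_finsetSum _ fun m _ => ?_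
    rw [← Finset.sum_const_zero]
    exact tendsto_finsetSum _ fun π hπ =>
      TwoSite.tendsto_QTilde_sub_Q hε hP (Finset.mem_filter.1 hπ).2 hlam
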